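/- Let $M$ be a connected $n$-dimensional $C^\infty$ manifold. A Finsler metric on $M$ is a function $F=F(x,y)$ on $TM$, $C^\infty$ on $TM\setminus\{0\}$, such that $F\ge 0$ with $F(x,y)=0$ iff $y=0$, $F(x,\lambda y)=\lambda F(x,y)$ for $\lambda\ge 0$, and $g_{ij}:=\tfrac12[F^2]_{y^iy^j}$ is positive definite for all $y\ne 0$. In local coordinates put $$G^i=\tfrac14 g^{il}\Big\{\frac{\partial^2[F^2]}{\partial x^m\partial y^l}y^m-\frac{\partial [F^2]}{\partial x^l}\Big\},\qquad \sigma_F(x)=\frac{\mathrm{Vol}(\mathbb B^n(1))}{\mathrm{Vol}\{y\in\mathbb R^n: F(x,y)<1\}},\qquad S=\frac{\partial G^m}{\partial y^m}-y^m\frac{\partial \ln\sigma_F}{\partial x^m},$$ where $\sigma_F(x)\,dx^1\cdots dx^n$ is the Busemann–Hausdorff volume form and $S$ is the S-curvature of $F$. Geodesics are the solutions of $\ddot x^i+2G^i(x,\dot x)=0$ with $\dot x\neq 0$. The metric $F$ is locally projectively flat if every point of $M$ has a local coordinate system in which all geodesics of $F$ are straight lines (i.e. contained in straight lines). Let $F$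 be a locally projectively flat Finsler metric on $M$ with almost isotropic S-curvature, that is, $$S=(n+1)(cF+\eta)\quad\text{on } TM\setminus\{0\},$$ where $c=c(x)$ is a $C^\infty$ scalar function on $M$ and $\eta=\eta_i(x)y^i$ is a closed $C^\infty$ 1-form on $M$. If $c$ is not constant on $M$, then $F$ is a Randers metric: $F=\alpha+\beta$ on $TM$, where $\alpha=\sqrt{a_{ij}(x)y^iy^j}$ is a $C^\infty$ Riemannian metric on $M$ and $\beta=b_i(x)y^i$ is a $C^\infty$ 1-form on $M$ with $\|\beta\|_\alpha<1$ at every point. -/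

import Mathlib

open Set MeasureTheory
open scoped Manifold ContDiff Topology

noncomputable section

/-! ### Finsler geometry in local coordinates

A function `F : E n → E n → ℝ`, `(x, y) ↦ F x y`, is the expression of a Finsler metric in the
standard coordinates of `TU = U × ℝⁿ`, with `x` the base point and `y` the direction. -/

/-- The coordinate space `ℝⁿ`. -/
abbrev E (n : ℕ) : Type := EuclideanSpace ℝ (Fin n)

/-- `∂f/∂xᵏ` at `(x, y)`. -/
def dX {n : ℕ} (f : E n → E n → ℝ) (k : Fin n) (x y : E n) : ℝ :=
  fderiv ℝ (fun z => f z y) x (EuclideanSpace.single k 1)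

/-- `∂f/∂yᵏ` at `(x, y)`. -/
def dY {n : ℕ} (f : E n → E n → ℝ) (k : Fin n) (x y : E n) : ℝ :=
  fderiv ℝ (fun w => f x w) y (EuclideanSpace.single k 1)

/-- `F²`. -/
def energy {n : ℕ} (F : E n → E n → ℝ) (x y : E n) : ℝ := F x y ^ 2

/-- The fundamental tensor `g_{ij} = ½ [F²]_{yⁱyʲ}`. -/
def fundamentalTensor {n : ℕ} (F : E n → E n → ℝ) (x y : E n) : Matrix (Fin n) (Fin n) ℝ :=
  Matrix.of fun i j => (1 / 2 : ℝ) * dY (dY (energy F) i) j x y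

/-- The geodesic coefficients
`Gⁱ = ¼ g^{il} { ∂²[F²]/∂xᵐ∂yˡ yᵐ - ∂[F²]/∂xˡ }`. -/
def geodesicCoeff {n : ℕ} (F : E n → E n → ℝ) (i : Fin n) (x y : E n) : ℝ :=
  (1 / 4 : ℝ) * ∑ l, (fundamentalTensor F x y)⁻¹ i l *
    ((∑ m, dX (dY (energy F) l) m x y * y m) - dX (energy F) l x y)

/-- The density `σ_F(x) = Vol(𝔹ⁿ(1)) / Vol{y : F(x, y) < 1}` of the Busemann–Hausdorff volume form
`dV_F = σ_F(x) dx¹ ⋯ dxⁿ`. -/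
def busemannHausdorffDensity {n : ℕ} (F : E n → E n → ℝ) (x : E n) : ℝ :=
  (volume (Metric.ball (0 : E n) 1)).toReal / (volume {y : E n | F x y < 1}).toReal

/-- The S-curvature `S = ∂Gᵐ/∂yᵐ - yᵐ ∂(ln σ_F)/∂xᵐ`. -/
def sCurvature {n : ℕ} (F : E n → E n → ℝ) (x y : E n) : ℝ :=
  (∑ m, dY (geodesicCoeff F m) m x y) -
    ∑ m, y m * dX (fun z _ => Real.log (busemannHausdorffDensity F z)) m x y

/-- `γ`, with velocity `v`, is a regular geodesic in `U` on the open interval `(a, b)`: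
it solves `γ'' + 2 G(γ, γ') = 0`. -/
structure IsGeodesicOn {n : ℕ} (F : E n → E n → ℝ) (U : Set (E n)) (a b : ℝ)
    (γ v : ℝ → E n) : Prop where
  mem : ∀ t ∈ Ioo a b, γ t ∈ U
  regular : ∀ t ∈ Ioo a b, v t ≠ 0
  velocity : ∀ t ∈ Ioo a b, HasDerivAt γ (v t) t
  equation : ∀ t ∈ Ioo a b, ∀ i : Fin n,
    HasDerivAt (fun s => v s i) (-(2 * geodesicCoeff F i (γ t) (v t))) t

/-- `F` is projectively flat in `U ⊆ ℝⁿ`: all geodesics are straight lines. -/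
def IsProjectivelyFlatOn {n : ℕ} (F : E n → E n → ℝ) (U : Set (E n)) : Prop :=
  ∀ (a b : ℝ) (γ v : ℝ → E n), IsGeodesicOn F U a b γ v → Collinear ℝ (γ '' Ioo a b)

/-! ### Finsler geometry on manifolds -/

section OnManifold

variable {n : ℕ} {M : Type*} [TopologicalSpace M] [ChartedSpace (E n) M]

/-- The expression `F(x, y) = F(yⁱ ∂/∂xⁱ|ₓ)` of a function on `TM` in the local coordinate system
`e`; it is meaningful for `x ∈ e.target`. -/
def inChart (e : OpenPartialHomeomorph M (E n)) (F : TangentBundle (𝓡 n) M → ℝ)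
    (x y : E n) : ℝ :=
  F ⟨e.symm x, mfderiv (𝓡 n) (𝓡 n) e.symm x y⟩

/-- The expression of a 1-form in the local coordinate system `e`. -/
def formInChart (e : OpenPartialHomeomorph M (E n))
    (β : ∀ p : M, TangentSpace (𝓡 n) p →L[ℝ] ℝ) (x : E n) : E n →L[ℝ] ℝ :=
  (β (e.symm x)).comp (mfderiv (𝓡 n) (𝓡 n) e.symm x)

/-- A `C^∞` 1-form: its components in every local coordinate system are `C^∞`. -/
def IsSmoothForm (β : ∀ p : M, TangentSpace (𝓡 n) p →L[ℝ] ℝ) : Prop :=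
  ∀ e ∈ IsManifold.maximalAtlas (𝓡 n) ∞ M, ContDiffOn ℝ ∞ (formInChart e β) e.target

/-- A closed 1-form: `∂ηⱼ/∂xⁱ = ∂ηᵢ/∂xʲ` in every local coordinate system. -/
def IsClosedForm (η : ∀ p : M, TangentSpace (𝓡 n) p →L[ℝ] ℝ) : Prop :=
  ∀ e ∈ IsManifold.maximalAtlas (𝓡 n) ∞ M, ∀ x ∈ e.target, ∀ u w : E n,
    fderiv ℝ (formInChart e η) x u w = fderiv ℝ (formInChart e η) x w u

/-- `F` is locally projectively flat: around every point there is a local coordinate system in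
which `F` is projectively flat. -/
def IsLocallyProjectivelyFlat (F : TangentBundle (𝓡 n) M → ℝ) : Prop :=
  ∀ p : M, ∃ e ∈ IsManifold.maximalAtlas (𝓡 n) ∞ M, p ∈ e.source ∧
    IsProjectivelyFlatOn (inChart e F) e.target

/-- `S = (n + 1)(c F + η)` on `TM ∖ 0`, where `S` is the S-curvature of `F`. -/
def SCurvatureEq (F : TangentBundle (𝓡 n) M → ℝ) (c : M → ℝ)
    (η : ∀ p : M, TangentSpace (𝓡 n) p →L[ℝ] ℝ) : Prop :=
  ∀ e ∈ IsManifold.maximalAtlas (𝓡 n) ∞ M, ∀ x ∈ e.target, ∀ y : E n, y ≠ 0 →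
    sCurvature (inChart e F) x y =
      (n + 1) * (c (e.symm x) * inChart e F x y + formInChart e η x y)

variable [IsManifold (𝓡 n) ∞ M]

/-- A Finsler metric on `M`. -/
structure IsFinslerMetric (F : TangentBundle (𝓡 n) M → ℝ) : Prop where
  smooth : ContMDiffOn (𝓡 n).tangent 𝓘(ℝ, ℝ) ∞ F {v | v.2 ≠ 0}
  nonneg : ∀ v, 0 ≤ F v
  eq_zero_iff : ∀ v, F v = 0 ↔ v.2 = 0
  homogeneous : ∀ (p : M) (y : TangentSpace (𝓡 n) p) (r : ℝ), 0 ≤ r →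
    F ⟨p, r • y⟩ = r * F ⟨p, y⟩
  strongly_convex : ∀ e ∈ IsManifold.maximalAtlas (𝓡 n) ∞ M, ∀ x ∈ e.target, ∀ y : E n, y ≠ 0 →
    (fundamentalTensor (inChart e F) x y).PosDef

/-- A `C^∞` Riemannian metric on `M`. -/
abbrev RiemannianMetric (n : ℕ) (M : Type*) [TopologicalSpace M] [ChartedSpace (E n) M]
    [IsManifold (𝓡 n) ∞ M] :=
  Bundle.ContMDiffRiemannianMetric (𝓡 n) ∞ (E n) (fun p : M => TangentSpace (𝓡 n) p)

/-- `‖β‖_α` at the point `p`: the dual norm `sup {β(y) : α(y) ≤ 1}`, where `α(y)² = a(y, y)`. -/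
def formNorm (a : RiemannianMetric n M) (β : ∀ p : M, TangentSpace (𝓡 n) p →L[ℝ] ℝ) (p : M) : ℝ :=
  sSup ((fun y => β p y) '' {y : TangentSpace (𝓡 n) p | a.inner p y y ≤ 1})

/-- `F` is a Randers metric: `F = α + β` with `α = √(a_{ij}(x) yⁱ yʲ)` a Riemannian metric and
`β = bᵢ(x) yⁱ` a 1-form such that `‖β‖_α < 1` at every point. -/
def IsRandersMetric (F : TangentBundle (𝓡 n) M → ℝ) : Prop :=
  ∃ (a : RiemannianMetric n M) (β : ∀ p : M, TangentSpace (𝓡 n) p →L[ℝ] ℝ),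
    IsSmoothForm β ∧ (∀ p, formNorm a β p < 1) ∧
      ∀ (p : M) (y : TangentSpace (𝓡 n) p), F ⟨p, y⟩ = Real.sqrt (a.inner p y y) + β p y

end OnManifold

end

/-! Assume `1 < n`; in lower dimension every positively homogeneous positive function is already of
Randers type. In projectively flat coordinates the geodesic coefficients are Gⁱ = P yⁱ with P =
F_{xᵏ}yᵏ/(2F), and F_{xᵘ} = (PF)_{yᵘ}. Then S = (n+1)P − d ln σ_F, so the S-curvature condition says
P = cF + θ with θ = η + d ln σ_F/(n+1) closed. Thus F solves the overdetermined system recorded in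
`FlatSystem`.

Commuting the x-derivatives of F and using Euler's relation shows that q/F² + 4c₀/F does not depend
on y, where c₀ = dc(y) and q = Dθ − θ⊗θ. Calling it τ(x), one gets τF² = 4c₀F + q
(`quadratic_equation`). Where τ ≠ 0, completing the square gives F = α + β with β = 2c₀/τ
(`FlatSystem.isRandersNorm`).

It remains to show that τ has no zeros. Differentiating the quadratic equation in x and separating
even and odd parts in y gives dτ = −8c dc and expresses the Hessian of c linearly in c and dc
(`fderiv_scalar_and_hessian`). Both are linear equations along segments, so a zero of τ forces c to
be constant on a whole ball, and so does local constancy of c at one point. Hence the set where c is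
locally constant is open and closed. As M is connected and c is not constant, this set is empty, so
τ ≠ 0 everywhere. Finally α² and β are smooth because they are built from the even and odd parts of
F. -/

noncomputable section

/-! ### The flat system: integrability and the quadratic equation for F. -/

/-- Local solutions of the overdetermined system `∂F/∂xᵘ = (2cF + θ) ∂F/∂yᵘ + F θᵤ` with `θ` closed,
to which a projectively flat metric of almost isotropic S-curvature is subject. -/
structure FlatSystem {V : Type*} [NormedAddCommGroup V] [NormedSpace ℝ V] (B : Set V)
    (F : V → V → ℝ) (c : V → ℝ) (θ : V → V →L[ℝ] ℝ) : Prop where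
  isOpen : IsOpen B
  smooth : ContDiffOn ℝ ∞ (fun z : V × V => F z.1 z.2) (B ×ˢ {0}ᶜ)
  pos : ∀ x ∈ B, ∀ y, y ≠ 0 → 0 < F x y
  homogeneous : ∀ x ∈ B, ∀ y, ∀ r : ℝ, 0 ≤ r → F x (r • y) = r * F x y
  smooth_c : ContDiffOn ℝ ∞ c B
  smooth_θ : ContDiffOn ℝ ∞ θ B
  closed : ∀ x ∈ B, ∀ u w, fderiv ℝ θ x u w = fderiv ℝ θ x w u
  system : ∀ x ∈ B, ∀ y, y ≠ 0 → ∀ u,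
    fderiv ℝ (fun z : V × V => F z.1 z.2) (x, y) (u, 0) =
      (2 * c x * F x y + θ x y) * fderiv ℝ (fun z : V × V => F z.1 z.2) (x, y) (0, u)
        + F x y * θ x u

namespace FlatSystem

variable {V : Type*} [NormedAddCommGroup V] [NormedSpace ℝ V] {B : Set V}
    {F : V → V → ℝ} {c : V → ℝ} {θ : V → V →L[ℝ] ℝ}

theorem isOpen_prod (h : FlatSystem B F c θ) : IsOpen (B ×ˢ ({0}ᶜ : Set V)) :=
  h.isOpen.prod isOpen_compl_singleton

theorem contDiffAt (h : FlatSystem B F c θ) {x y : V} (hx : x ∈ B) (hy : y ≠ 0) :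
    ContDiffAt ℝ ∞ (fun z : V × V => F z.1 z.2) (x, y) :=
  h.smooth.contDiffAt (h.isOpen_prod.mem_nhds (mk_mem_prod hx hy))

theorem hasFDerivAt (h : FlatSystem B F c θ) {x y : V} (hx : x ∈ B) (hy : y ≠ 0) :
    HasFDerivAt (fun z : V × V => F z.1 z.2) (fderiv ℝ (fun z : V × V => F z.1 z.2) (x, y))
      (x, y) :=
  ((h.contDiffAt hx hy).differentiableAt (by simp)).hasFDerivAt

theorem contDiffAt_c (h : FlatSystem B F c θ) {x : V} (hx : x ∈ B) : ContDiffAt ℝ ∞ c x :=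
  h.smooth_c.contDiffAt (h.isOpen.mem_nhds hx)

theorem contDiffAt_θ (h : FlatSystem B F c θ) {x : V} (hx : x ∈ B) : ContDiffAt ℝ ∞ θ x :=
  h.smooth_θ.contDiffAt (h.isOpen.mem_nhds hx)

theorem hasFDerivAt_c (h : FlatSystem B F c θ) {x : V} (hx : x ∈ B) :
    HasFDerivAt c (fderiv ℝ c x) x :=
  ((h.contDiffAt_c hx).differentiableAt (by simp)).hasFDerivAt

theorem hasFDerivAt_θ (h : FlatSystem B F c θ) {x : V} (hx : x ∈ B) :
    HasFDerivAt θ (fderiv ℝ θ x) x :=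
  ((h.contDiffAt_θ hx).differentiableAt (by simp)).hasFDerivAt

theorem hasFDerivAt_fderiv_c (h : FlatSystem B F c θ) {x : V} (hx : x ∈ B) :
    HasFDerivAt (fderiv ℝ c) (fderiv ℝ (fderiv ℝ c) x) x :=
  (((h.contDiffAt_c hx).fderiv_right (m := 1) (by norm_cast)).differentiableAt
    (by simp)).hasFDerivAt

theorem hasFDerivAt_fderiv_θ (h : FlatSystem B F c θ) {x : V} (hx : x ∈ B) :
    HasFDerivAt (fderiv ℝ θ) (fderiv ℝ (fderiv ℝ θ) x) x :=
  (((h.contDiffAt_θ hx).fderiv_right (m := 1) (by norm_cast)).differentiableAt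
    (by simp)).hasFDerivAt

/-- Euler's relation. -/
theorem fderiv_self (h : FlatSystem B F c θ) {x y : V} (hx : x ∈ B) (hy : y ≠ 0) :
    fderiv ℝ (fun z : V × V => F z.1 z.2) (x, y) (0, y) = F x y := by
  have h1 : HasDerivAt (fun t : ℝ => (x, t • y)) ((0 : V), y) 1 := by
    have := (hasDerivAt_const (1 : ℝ) x).prodMk ((hasDerivAt_id (1 : ℝ)).smul_const y)
    simpa using this
  have h2 : HasDerivAt (fun t : ℝ => F x (t • y))
      (fderiv ℝ (fun z : V × V => F z.1 z.2) (x, y) (0, y)) 1 := by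
    have h0 := h.hasFDerivAt hx hy
    have h3 : HasFDerivAt (fun z : V × V => F z.1 z.2)
      (fderiv ℝ (fun z : V × V => F z.1 z.2) (x, y)) (x, (1 : ℝ) • y) := by simpa using h0
    exact h3.comp_hasDerivAt (1 : ℝ) h1
  have h4 : HasDerivAt (fun t : ℝ => F x (t • y)) (F x y) 1 := by
    have : HasDerivAt (fun t : ℝ => t * F x y) (F x y) 1 := by
      simpa using (hasDerivAt_id (1 : ℝ)).mul_const (F x y)
    refine this.congr_of_eventuallyEq ?_
    filter_upwards [lt_mem_nhds (zero_lt_one : (0 : ℝ) < 1)] with t ht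
    exact h.homogeneous x hx y t ht.le
  exact h2.unique h4

/-- Derivative of the system in an arbitrary direction `(a, b)`. -/
theorem fderiv_system (h : FlatSystem B F c θ) {x y : V} (hx : x ∈ B) (hy : y ≠ 0) (a b u : V) :
    fderiv ℝ (fderiv ℝ (fun z : V × V => F z.1 z.2)) (x, y) (a, b) (u, 0) =
      (2 * fderiv ℝ c x a * F x y
        + 2 * c x * fderiv ℝ (fun z : V × V => F z.1 z.2) (x, y) (a, b)
        + fderiv ℝ θ x a y + θ x b) * fderiv ℝ (fun z : V × V => F z.1 z.2) (x, y) (0, u)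
      + (2 * c x * F x y + θ x y)
        * fderiv ℝ (fderiv ℝ (fun z : V × V => F z.1 z.2)) (x, y) (a, b) (0, u)
      + fderiv ℝ (fun z : V × V => F z.1 z.2) (x, y) (a, b) * θ x u
      + F x y * fderiv ℝ θ x a u := by
  set f : V × V → ℝ := fun z => F z.1 z.2 with hf
  have hd : HasFDerivAt (fderiv ℝ f) (fderiv ℝ (fderiv ℝ f) (x, y)) (x, y) :=
    (((h.contDiffAt hx hy).fderiv_right (m := 1) (by norm_cast)).differentiableAt
      (by simp)).hasFDerivAt
  have hev (v : V × V) : HasFDerivAt (fun z => fderiv ℝ f z v)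
      ((fderiv ℝ (fderiv ℝ f) (x, y)).flip v) (x, y) := by
    have := hd.clm_apply (hasFDerivAt_const v (x, y))
    simpa using this
  have hc : HasFDerivAt (fun z : V × V => c z.1)
      ((fderiv ℝ c x).comp (ContinuousLinearMap.fst ℝ V V)) (x, y) :=
    HasFDerivAt.comp (x, y) (h.hasFDerivAt_c hx) hasFDerivAt_fst
  have hθ : HasFDerivAt (fun z : V × V => θ z.1)
      ((fderiv ℝ θ x).comp (ContinuousLinearMap.fst ℝ V V)) (x, y) :=
    HasFDerivAt.comp (x, y) (h.hasFDerivAt_θ hx) hasFDerivAt_fst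
  have hF := h.hasFDerivAt hx hy
  have hR := ((((hc.const_mul 2).mul hF).add (hθ.clm_apply hasFDerivAt_snd)).mul (hev (0, u))).add
    (hF.mul (hθ.clm_apply (hasFDerivAt_const u (x, y))))
  have hL := (hev (u, 0)).congr_of_eventuallyEq (f₁ := fun z : V × V =>
      (2 * c z.1 * F z.1 z.2 + θ z.1 z.2) * fderiv ℝ f z (0, u) + F z.1 z.2 * θ z.1 u) (by
    filter_upwards [h.isOpen_prod.mem_nhds (mk_mem_prod hx hy)] with z hz
    exact (h.system z.1 hz.1 z.2 hz.2 u).symm)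
  have := congrArg (fun L : V × V →L[ℝ] ℝ => L (a, b)) (hL.unique hR)
  simp at this
  rw [this]
  ring

/-- This is F_{xᵘxʷ} = F_{xʷxᵘ}. Each side is expanded by the system, and the mixed terms F_{xy} by
the system again; the second vertical derivatives cancel by symmetry, and the term F·Dθ(u, w)
cancels because θ is closed. -/
theorem integrability (h : FlatSystem B F c θ) {x y : V} (hx : x ∈ B) (hy : y ≠ 0) (u w : V) :
    fderiv ℝ (fun z : V × V => F z.1 z.2) (x, y) (0, u)
        * (2 * F x y * fderiv ℝ c x w - θ x y * θ x w + fderiv ℝ θ x w y) =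
      fderiv ℝ (fun z : V × V => F z.1 z.2) (x, y) (0, w)
        * (2 * F x y * fderiv ℝ c x u - θ x y * θ x u + fderiv ℝ θ x u y) := by
  have hs : ∀ v v' : V × V, fderiv ℝ (fderiv ℝ (fun z : V × V => F z.1 z.2)) (x, y) v v' =
      fderiv ℝ (fderiv ℝ (fun z : V × V => F z.1 z.2)) (x, y) v' v := by
    have := (h.contDiffAt hx hy).isSymmSndFDerivAt (by simp; norm_cast)
    exact fun v v' => this v v'
  have e1 := h.fderiv_system hx hy w 0 u
  have e2 := h.fderiv_system hx hy u 0 w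
  have e3 := h.fderiv_system hx hy 0 u w
  have e4 := h.fderiv_system hx hy 0 w u
  rw [hs (w, 0) (0, u)] at e1
  rw [hs (u, 0) (0, w)] at e2
  rw [e3] at e1
  rw [e4] at e2
  rw [hs (w, 0) (u, 0), e2, hs (0, w) (0, u), h.system x hx y hy u, h.system x hx y hy w,
    h.closed x hx u w] at e1
  simp at e1
  linear_combination -e1

/-- The quadratic form `q = Dθ - θ ⊗ θ`. -/
def quad (θ : V → V →L[ℝ] ℝ) (x y w : V) : ℝ := fderiv ℝ θ x y w - θ x y * θ x w

/-- The scalar `τ` with `τ F² = 4 c₀ F + q`, evaluated with the help of the direction `y`. -/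
def scalar (F : V → V → ℝ) (c : V → ℝ) (θ : V → V →L[ℝ] ℝ) (y x : V) : ℝ :=
  quad θ x y y * (F x y)⁻¹ ^ 2 + 4 * fderiv ℝ c x y * (F x y)⁻¹

theorem quad_symm (h : FlatSystem B F c θ) {x : V} (hx : x ∈ B) (y w : V) :
    quad θ x y w = quad θ x w y := by
  rw [quad, quad, h.closed x hx y w, mul_comm]

theorem quad_neg (x y : V) : quad θ x (-y) (-y) = quad θ x y y := by
  simp [quad]

theorem hasFDerivAt_vertical (h : FlatSystem B F c θ) {x y : V} (hx : x ∈ B) (hy : y ≠ 0) :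
    HasFDerivAt (F x) ((fderiv ℝ (fun z : V × V => F z.1 z.2) (x, y)).comp
      (ContinuousLinearMap.inr ℝ V V)) y := by
  have := h.hasFDerivAt hx hy
  exact HasFDerivAt.comp (g := fun z : V × V => F z.1 z.2) y this (hasFDerivAt_prodMk_right x y)

theorem hasFDerivAt_horizontal (h : FlatSystem B F c θ) {x y : V} (hx : x ∈ B) (hy : y ≠ 0) :
    HasFDerivAt (fun x => F x y) ((fderiv ℝ (fun z : V × V => F z.1 z.2) (x, y)).comp
      (ContinuousLinearMap.inl ℝ V V)) x := by
  have := h.hasFDerivAt hx hy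
  exact HasFDerivAt.comp (g := fun z : V × V => F z.1 z.2) (f := fun x => (x, y)) x this
    (hasFDerivAt_prodMk_left x y)

theorem hasFDerivAt_quad_vertical (h : FlatSystem B F c θ) {x : V} (hx : x ∈ B) (y : V) :
    ∃ L : V →L[ℝ] ℝ, HasFDerivAt (fun y => quad θ x y y) L y ∧ ∀ u, L u = 2 * quad θ x u y := by
  have h1 := ((fderiv ℝ θ x).hasFDerivAt (x := y)).clm_apply (hasFDerivAt_id y)
  have h2 := ((θ x).hasFDerivAt (x := y)).mul ((θ x).hasFDerivAt (x := y))
  refine ⟨_, h1.sub h2, fun u => ?_⟩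
  simp [quad, h.closed x hx y u]
  ring

theorem hasFDerivAt_inv {g : V → ℝ} {L : V →L[ℝ] ℝ} {y : V} (hg : HasFDerivAt g L y)
    (h0 : g y ≠ 0) : HasFDerivAt (fun y => (g y)⁻¹) ((-(g y ^ 2)⁻¹) • L) y :=
  (hasDerivAt_inv h0).comp_hasFDerivAt y hg

/-- By `integrability` with w = y and Euler's relation, the y-derivative of `scalar` vanishes; the
punctured space is connected because the dimension exceeds one. -/
theorem scalar_eq (h : FlatSystem B F c θ) (hV : 1 < Module.rank ℝ V) {x y y' : V} (hx : x ∈ B)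
    (hy : y ≠ 0) (hy' : y' ≠ 0) : scalar F c θ y x = scalar F c θ y' x := by
  have key : ∀ y : V, y ≠ 0 → HasFDerivAt (fun y => scalar F c θ y x) (0 : V →L[ℝ] ℝ) y := by
    intro y hy
    obtain ⟨L, hL, hLu⟩ := h.hasFDerivAt_quad_vertical hx y
    have hF0 : F x y ≠ 0 := (h.pos x hx y hy).ne'
    have hi := hasFDerivAt_inv (h.hasFDerivAt_vertical hx hy) hF0
    have := (hL.mul (hi.pow 2)).add ((((fderiv ℝ c x).hasFDerivAt (x := y)).const_mul 4).mul hi)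
    refine HasFDerivAt.congr_fderiv this ?_
    ext u
    have e := h.integrability hx hy u y
    rw [h.fderiv_self hx hy] at e
    have e1 : fderiv ℝ θ x u y = quad θ x u y + θ x u * θ x y := by rw [quad]; ring
    have e2 : fderiv ℝ θ x y y = quad θ x y y + θ x y * θ x y := by rw [quad]; ring
    rw [e1, e2] at e
    simp [hLu]
    field_simp
    linear_combination (-2) * e
  exact isOpen_compl_singleton.is_const_of_fderiv_eq_zero (𝕜 := ℝ)
    (f := fun y => scalar F c θ y x)
    (isConnected_compl_singleton_of_one_lt_rank hV 0).isPreconnected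
    (fun z hz => (key z hz).differentiableAt.differentiableWithinAt)
    (fun z hz => (key z hz).fderiv) hy hy'

theorem quadratic_equation (h : FlatSystem B F c θ) (hV : 1 < Module.rank ℝ V) {x y y₀ : V}
    (hx : x ∈ B) (hy : y ≠ 0) (hy₀ : y₀ ≠ 0) :
    scalar F c θ y₀ x * F x y ^ 2 = 4 * fderiv ℝ c x y * F x y + quad θ x y y := by
  rw [h.scalar_eq hV hx hy₀ hy, scalar]
  have hF0 : F x y ≠ 0 := (h.pos x hx y hy).ne'
  field_simp
  ring

/-- q is even and dc odd in y: subtract the quadratic equations at y and −y and divide by F(y) +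
F(−y) > 0. -/
theorem fderiv_c_eq (h : FlatSystem B F c θ) (hV : 1 < Module.rank ℝ V) {x y y₀ : V}
    (hx : x ∈ B) (hy : y ≠ 0) (hy₀ : y₀ ≠ 0) :
    4 * fderiv ℝ c x y = scalar F c θ y₀ x * (F x y - F x (-y)) := by
  have h1 := h.quadratic_equation hV hx hy hy₀
  have h2 := h.quadratic_equation hV hx (neg_ne_zero.mpr hy) hy₀
  rw [quad_neg, map_neg] at h2
  have hp : 0 < F x y + F x (-y) :=
    add_pos (h.pos x hx y hy) (h.pos x hx _ (neg_ne_zero.mpr hy))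
  refine mul_right_cancel₀ hp.ne' ?_
  linear_combination h2 - h1

theorem quadratic_equation_vertical (h : FlatSystem B F c θ) (hV : 1 < Module.rank ℝ V)
    {x y y₀ : V} (hx : x ∈ B) (hy : y ≠ 0) (hy₀ : y₀ ≠ 0) (u : V) :
    (2 * scalar F c θ y₀ x * F x y - 4 * fderiv ℝ c x y)
        * fderiv ℝ (fun z : V × V => F z.1 z.2) (x, y) (0, u) =
      4 * fderiv ℝ c x u * F x y + 2 * quad θ x u y := by
  obtain ⟨L, hL, hLu⟩ := h.hasFDerivAt_quad_vertical hx y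
  have hF := h.hasFDerivAt_vertical hx hy
  have h1 := (hF.pow 2).const_mul (scalar F c θ y₀ x)
  have h2 := ((((fderiv ℝ c x).hasFDerivAt (x := y)).const_mul 4).mul hF).add hL
  have h3 := h2.congr_of_eventuallyEq (f₁ := fun y => scalar F c θ y₀ x * F x y ^ 2) (by
    filter_upwards [isOpen_compl_singleton.mem_nhds hy] with z hz
    exact h.quadratic_equation hV hx hz hy₀)
  have := congrArg (fun L : V →L[ℝ] ℝ => L u) (h1.unique h3)
  simp [hLu] at this
  linear_combination this

/-- The derivative of `quad`. -/
def dquad (θ : V → V →L[ℝ] ℝ) (x u y w : V) : ℝ :=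
  fderiv ℝ (fderiv ℝ θ) x u y w - fderiv ℝ θ x u y * θ x w - θ x y * fderiv ℝ θ x u w

theorem hasFDerivAt_quad (h : FlatSystem B F c θ) {x : V} (hx : x ∈ B) (y w : V) :
    ∃ L : V →L[ℝ] ℝ, HasFDerivAt (fun x => quad θ x y w) L x ∧ ∀ u, L u = dquad θ x u y w := by
  have hθ (y : V) := (h.hasFDerivAt_θ hx).clm_apply (hasFDerivAt_const y x)
  have h1 := ((h.hasFDerivAt_fderiv_θ hx).clm_apply (hasFDerivAt_const y x)).clm_apply
    (hasFDerivAt_const w x)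
  refine ⟨_, h1.sub ((hθ y).mul (hθ w)), fun u => ?_⟩
  simp [dquad]
  ring

theorem fderiv_fderiv_θ_symm_right (h : FlatSystem B F c θ) {x : V} (hx : x ∈ B) (u y w : V) :
    fderiv ℝ (fderiv ℝ θ) x u y w = fderiv ℝ (fderiv ℝ θ) x u w y := by
  have h1 (y w : V) := ((h.hasFDerivAt_fderiv_θ hx).clm_apply (hasFDerivAt_const y x)).clm_apply
    (hasFDerivAt_const w x)
  have h2 := (h1 w y).congr_of_eventuallyEq (f₁ := fun x => fderiv ℝ θ x y w) (by
    filter_upwards [h.isOpen.mem_nhds hx] with z hz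
    exact h.closed z hz y w)
  have := congrArg (fun L : V →L[ℝ] ℝ => L u) ((h1 y w).unique h2)
  simpa using this

theorem fderiv_fderiv_θ_symm_left (h : FlatSystem B F c θ) {x : V} (hx : x ∈ B) (u y w : V) :
    fderiv ℝ (fderiv ℝ θ) x u y w = fderiv ℝ (fderiv ℝ θ) x y u w := by
  have := (h.contDiffAt_θ hx).isSymmSndFDerivAt (by simp; norm_cast)
  rw [this u y]

theorem hasFDerivAt_scalar (h : FlatSystem B F c θ) {x y : V} (hx : x ∈ B) (hy : y ≠ 0) :
    HasFDerivAt (scalar F c θ y) (fderiv ℝ (scalar F c θ y) x) x := by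
  obtain ⟨L, hL, -⟩ := h.hasFDerivAt_quad hx y y
  have hi := hasFDerivAt_inv (h.hasFDerivAt_horizontal hx hy) (h.pos x hx y hy).ne'
  have hc := (h.hasFDerivAt_fderiv_c hx).clm_apply (hasFDerivAt_const y x)
  have := (hL.mul (hi.pow 2)).add ((hc.const_mul 4).mul hi)
  exact this.differentiableAt.hasFDerivAt

/-- The trilinear form arising from the derivative of the quadratic equation. -/
def cubic (θ : V → V →L[ℝ] ℝ) (x u y w : V) : ℝ :=
  θ x y * quad θ x u w + θ x w * quad θ x u y + 2 * quad θ x y w * θ x u - dquad θ x u y w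

theorem cubic_symm_right (h : FlatSystem B F c θ) {x : V} (hx : x ∈ B) (u y w : V) :
    cubic θ x u y w = cubic θ x u w y := by
  simp only [cubic, dquad, h.quad_symm hx y w, h.fderiv_fderiv_θ_symm_right hx u y w]
  ring

/-- Substituting Dθ = q + θ⊗θ in `dquad` turns `cubic` into 2(θ(u)q(y,w) + θ(y)q(u,w) + θ(w)q(u,y))
+ 2θ(u)θ(y)θ(w) − D²θ(u,y,w). This is totally symmetric, as D²θ is for closed θ. -/
theorem cubic_symm_left (h : FlatSystem B F c θ) {x : V} (hx : x ∈ B) (u y w : V) :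
    cubic θ x u y w = cubic θ x y u w := by
  simp only [cubic, dquad, quad, h.closed x hx y u, h.fderiv_fderiv_θ_symm_left hx u y w]
  ring

theorem cubic_eq_zero_of_diag (h : FlatSystem B F c θ) {x u : V} (hx : x ∈ B)
    (h0 : ∀ y, cubic θ x u y y = 0) (y w : V) : cubic θ x u y w = 0 := by
  have h1 := h0 (y + w)
  have h2 : cubic θ x u (y + w) (y + w) =
      cubic θ x u y y + cubic θ x u w w + cubic θ x u y w + cubic θ x u w y := by
    simp only [cubic, dquad, quad, map_add, add_apply]
    ring
  rw [h2, h0, h0, h.cubic_symm_right hx u w y] at h1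
  linarith

/-- The derivative of the quadratic equation, as a polynomial equation for `F`. -/
theorem quadratic_equation_horizontal (h : FlatSystem B F c θ) (hV : 1 < Module.rank ℝ V)
    {x y y₀ : V} (hx : x ∈ B) (hy : y ≠ 0) (hy₀ : y₀ ≠ 0) (u : V) :
    (fderiv ℝ (scalar F c θ y₀) x u + 8 * c x * fderiv ℝ c x u) * F x y ^ 2
      + (4 * c x * quad θ x u y + 4 * θ x y * fderiv ℝ c x u + 4 * fderiv ℝ c x y * θ x u
          - 4 * fderiv ℝ (fderiv ℝ c) x u y) * F x y
      + cubic θ x u y y = 0 := by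
  obtain ⟨L, hL, hLu⟩ := h.hasFDerivAt_quad hx y y
  have hF := h.hasFDerivAt_horizontal hx hy
  have hc := (h.hasFDerivAt_fderiv_c hx).clm_apply (hasFDerivAt_const y x)
  have h1 := (h.hasFDerivAt_scalar hx hy₀).mul (hF.pow 2)
  have h2 := ((hc.const_mul 4).mul hF).add hL
  have h3 := h2.congr_of_eventuallyEq
    (f₁ := fun x => scalar F c θ y₀ x * F x y ^ 2) (by
    filter_upwards [h.isOpen.mem_nhds hx] with z hz
    exact h.quadratic_equation hV hz hy hy₀)
  have e := congrArg (fun L : V →L[ℝ] ℝ => L u) (h1.unique h3)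
  simp [hLu] at e
  -- The system trades F_{xᵘ} for F_{yᵘ}; `e1` then removes F_{yᵘ} and `e2` removes τ itself,
  -- leaving a polynomial in F.
  rw [h.system x hx y hy u] at e
  have e1 := h.quadratic_equation_vertical hV hx hy hy₀ u
  have e2 := h.quadratic_equation hV hx hy hy₀
  simp only [cubic]
  linear_combination e - (2 * c x * F x y + θ x y) * e1 - 2 * θ x u * e2

theorem exists_ne_zero_apply_eq_zero (hV : 1 < Module.rank ℝ V) (a : V →L[ℝ] ℝ) :
    ∃ u, u ≠ 0 ∧ a u = 0 := by
  by_contra! hcon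
  have hinj : Function.Injective (a : V →ₗ[ℝ] ℝ) := by
    rw [← LinearMap.ker_eq_bot, LinearMap.ker_eq_bot']
    intro m hm
    by_contra hm0
    exact hcon m hm0 hm
  have := LinearMap.lift_rank_le_of_injective _ hinj
  simp only [Module.rank_self, Cardinal.lift_one, Cardinal.lift_uzero] at this
  exact absurd hV (not_lt.mpr this)

/-- Write the horizontal equation as a(u)F² + ℓF + `cubic` = 0, with a = dτ + 8c dc. Here ℓ is odd
and `cubic` even in y, so comparing y with −y gives ℓ = −a(u)(F(y) − F(−y)) and `cubic` =
−a(u)F(y)F(−y). Symmetry of `cubic` forces a = 0; then ℓ = 0 is the Hessian formula. -/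
theorem fderiv_scalar_and_hessian (h : FlatSystem B F c θ) (hV : 1 < Module.rank ℝ V)
    {x y₀ : V} (hx : x ∈ B) (hy₀ : y₀ ≠ 0) :
    (∀ u, fderiv ℝ (scalar F c θ y₀) x u = -8 * c x * fderiv ℝ c x u) ∧
    ∀ u y, fderiv ℝ (fderiv ℝ c) x u y =
      θ x y * fderiv ℝ c x u + θ x u * fderiv ℝ c x y + c x * quad θ x u y := by
  set a : V →L[ℝ] ℝ := fderiv ℝ (scalar F c θ y₀) x + (8 * c x) • fderiv ℝ c x with ha
  have hau (u : V) : a u = fderiv ℝ (scalar F c θ y₀) x u + 8 * c x * fderiv ℝ c x u := by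
    simp [ha]
  have parity : ∀ u y, y ≠ 0 →
      4 * c x * quad θ x u y + 4 * θ x y * fderiv ℝ c x u + 4 * fderiv ℝ c x y * θ x u
          - 4 * fderiv ℝ (fderiv ℝ c) x u y = - a u * (F x y - F x (-y)) := by
    intro u y hy
    have h1 := h.quadratic_equation_horizontal hV hx hy hy₀ u
    have h2 := h.quadratic_equation_horizontal hV hx (neg_ne_zero.mpr hy) hy₀ u
    have e1 : cubic θ x u (-y) (-y) = cubic θ x u y y := by
      simp [cubic, dquad, quad]
      ring
    have e2 : quad θ x u (-y) = - quad θ x u y := by simp [quad]; ring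
    rw [e1, e2] at h2
    simp only [map_neg] at h2
    have hp : 0 < F x y + F x (-y) :=
      add_pos (h.pos x hx y hy) (h.pos x hx _ (neg_ne_zero.mpr hy))
    refine mul_right_cancel₀ hp.ne' ?_
    rw [hau]
    linear_combination h1 - h2
  have hcub : ∀ u y, y ≠ 0 → cubic θ x u y y = - a u * (F x y * F x (-y)) := by
    intro u y hy
    have h1 := h.quadratic_equation_horizontal hV hx hy hy₀ u
    have h2 := parity u y hy
    rw [hau] at h2 ⊢
    linear_combination h1 - F x y * h2
  -- For v ≠ 0 in the kernel of a, the form `cubic` vanishes with v in the first slot; by symmetry 0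
  -- = cubic(u, v, v) = −a(u)F(v)F(−v) for every u.
  obtain ⟨v, hv0, hv⟩ := exists_ne_zero_apply_eq_zero hV a
  have hcv : ∀ y w, cubic θ x v y w = 0 := by
    refine h.cubic_eq_zero_of_diag hx fun y => ?_
    rcases eq_or_ne y 0 with rfl | hy
    · simp [cubic, dquad, quad]
    · rw [hcub v y hy, hv]; simp
  have ha0 : ∀ u, a u = 0 := by
    intro u
    have h1 := hcub u v hv0
    rw [h.cubic_symm_left hx u v v, hcv] at h1
    have hp : 0 < F x v * F x (-v) :=
      mul_pos (h.pos x hx v hv0) (h.pos x hx _ (neg_ne_zero.mpr hv0))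
    rcases mul_eq_zero.mp h1.symm with h2 | h2
    · linarith
    · exact absurd h2 hp.ne'
  refine ⟨fun u => ?_, fun u y => ?_⟩
  · have := ha0 u
    rw [hau] at this
    linarith
  · rcases eq_or_ne y 0 with rfl | hy
    · simp [quad]
    · have := parity u y hy
      rw [ha0] at this
      linarith

end FlatSystem

/-! ### Unique continuation for c and τ, and the Randers form of F. -/

/-- A Minkowski norm of Randers type, `N = α + β` with `α` Euclidean and `β` linear. -/
def IsRandersNorm {V : Type*} [AddCommGroup V] [Module ℝ V] [TopologicalSpace V] (N : V → ℝ) :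
    Prop :=
  ∃ (a : V →L[ℝ] V →L[ℝ] ℝ) (b : V →L[ℝ] ℝ), (∀ v w, a v w = a w v) ∧
    (∀ v, v ≠ 0 → 0 < a v v) ∧ ∀ v, N v = Real.sqrt (a v v) + b v

/-- A function on a convex open set vanishes if it vanishes at a point and its directional
derivatives are bounded by multiples of the function. -/
theorem Convex.eq_zero_of_norm_fderiv_le {V W : Type*} [NormedAddCommGroup V] [NormedSpace ℝ V]
    [NormedAddCommGroup W] [NormedSpace ℝ W] {B : Set V} (hB : Convex ℝ B)
    {g : V → W} {g' : V → V →L[ℝ] W} (hg : ∀ x ∈ B, HasFDerivAt g (g' x) x)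
    (hK : ∀ u, u ≠ 0 → ∃ K : V → ℝ, ContinuousOn K B ∧ ∀ x ∈ B, ‖g' x u‖ ≤ K x * ‖g x‖)
    {x₀ x : V} (hx₀ : x₀ ∈ B) (h0 : g x₀ = 0) (hx : x ∈ B) : g x = 0 := by
  rcases eq_or_ne (x - x₀) 0 with hu | hu
  · rw [sub_eq_zero.mp hu, h0]
  obtain ⟨K, hKc, hK⟩ := hK _ hu
  set γ : ℝ → V := fun t => x₀ + t • (x - x₀) with hγ
  have hmem : ∀ t ∈ Icc (0 : ℝ) 1, γ t ∈ B := fun t ht => hB.add_smul_sub_mem hx₀ hx ht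
  have hγ' : ∀ t, HasDerivAt γ (x - x₀) t := fun t => by
    simpa [hγ] using ((hasDerivAt_id t).smul_const (x - x₀)).const_add x₀
  have hγc : Continuous γ := continuous_iff_continuousAt.mpr fun t => (hγ' t).continuousAt
  have hd : ∀ t ∈ Icc (0 : ℝ) 1, HasDerivAt (g ∘ γ) (g' (γ t) (x - x₀)) t := fun t ht =>
    (hg _ (hmem t ht)).comp_hasDerivAt t (hγ' t)
  obtain ⟨C, hC⟩ := (isCompact_Icc (a := (0 : ℝ)) (b := 1)).bddAbove_image
    (hKc.comp hγc.continuousOn hmem)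
  have := eq_zero_of_abs_deriv_le_mul_abs_self_of_eq_zero_right (f := g ∘ γ)
    (f' := fun t => g' (γ t) (x - x₀)) (K := C) (a := 0) (b := 1)
    (fun t ht => (hd t ht).continuousAt.continuousWithinAt)
    (fun t ht => (hd t (Ico_subset_Icc_self ht)).hasDerivWithinAt)
    (by simp [hγ, h0])
    (fun t ht => (hK _ (hmem t (Ico_subset_Icc_self ht))).trans
      (mul_le_mul_of_nonneg_right (hC (mem_image_of_mem _ (Ico_subset_Icc_self ht)))
        (norm_nonneg _))) 1 (by simp)
  simpa [hγ] using this

namespace FlatSystem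

variable {V : Type*} [NormedAddCommGroup V] [NormedSpace ℝ V] {B : Set V}
    {F : V → V → ℝ} {c : V → ℝ} {θ : V → V →L[ℝ] ℝ}

theorem continuousOn_horizontal (h : FlatSystem B F c θ) {y : V} (hy : y ≠ 0) :
    ContinuousOn (fun x => F x y) B := fun _ hx =>
  (h.hasFDerivAt_horizontal hx hy).continuousAt.continuousWithinAt

theorem eq_const_of_fderiv_c_eq_zero (h : FlatSystem B F c θ) (hB : Convex ℝ B)
    (h0 : ∀ x ∈ B, fderiv ℝ c x = 0) {x₀ x : V} (hx₀ : x₀ ∈ B) (hx : x ∈ B) : c x = c x₀ :=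
  h.isOpen.is_const_of_fderiv_eq_zero hB.isPreconnected
    (fun _ hz => (h.hasFDerivAt_c hz).differentiableAt.differentiableWithinAt) h0 hx hx₀

/-- Combining dτ = −8c dc with 4dc(u) = τ(F(u) − F(−u)) gives dτ(u) = −2c(F(u) − F(−u))τ, which is
linear in τ. So τ vanishes on B, and then so does dc. -/
theorem eq_const_of_scalar_eq_zero (h : FlatSystem B F c θ) (hB : Convex ℝ B)
    (hV : 1 < Module.rank ℝ V) {x₀ y₀ : V} (hx₀ : x₀ ∈ B) (hy₀ : y₀ ≠ 0)
    (h0 : scalar F c θ y₀ x₀ = 0) {x : V} (hx : x ∈ B) : c x = c x₀ := by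
  have hs : ∀ x ∈ B, scalar F c θ y₀ x = 0 := by
    intro x hx
    refine hB.eq_zero_of_norm_fderiv_le (fun x hx => h.hasFDerivAt_scalar hx hy₀) ?_ hx₀ h0 hx
    intro u hu
    refine ⟨fun x => ‖2 * c x * (F x u - F x (-u))‖, ?_, fun x hx => ?_⟩
    · exact ((continuousOn_const.mul h.smooth_c.continuousOn).mul
        ((h.continuousOn_horizontal hu).sub
          (h.continuousOn_horizontal (neg_ne_zero.mpr hu)))).norm
    · rw [← norm_mul, (h.fderiv_scalar_and_hessian hV hx hy₀).1 u, ← norm_neg]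
      refine le_of_eq (congrArg _ ?_)
      linear_combination 2 * c x * h.fderiv_c_eq hV hx hu hy₀
  refine h.eq_const_of_fderiv_c_eq_zero hB (fun z hz => ?_) hx₀ hx
  ext u
  rcases eq_or_ne u 0 with rfl | hu
  · simp
  · have := h.fderiv_c_eq hV hz hu hy₀
    rw [hs z hz] at this
    simpa using this

/-- The Hessian formula makes the pair (c, dc) satisfy a linear first-order system, so the 1-jet of
c at one point decides. -/
theorem eq_zero_of_eventually_eq_zero (h : FlatSystem B F c θ) (hB : Convex ℝ B)
    (hV : 1 < Module.rank ℝ V) {x₀ y₀ : V} (hx₀ : x₀ ∈ B) (hy₀ : y₀ ≠ 0) (h0 : c x₀ = 0)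
    (h0' : fderiv ℝ c x₀ = 0) {x : V} (hx : x ∈ B) : c x = 0 := by
  have hθc : ContinuousOn θ B := h.smooth_θ.continuousOn
  have hθc' : ContinuousOn (fderiv ℝ θ) B := fun x hx =>
    (h.hasFDerivAt_fderiv_θ hx).continuousAt.continuousWithinAt
  have := hB.eq_zero_of_norm_fderiv_le (g := fun x => (c x, fderiv ℝ c x))
    (g' := fun x => (fderiv ℝ c x).prod (fderiv ℝ (fderiv ℝ c) x))
    (fun x hx => (h.hasFDerivAt_c hx).prodMk (h.hasFDerivAt_fderiv_c hx)) ?_ hx₀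
    (by simp [h0, h0']) hx
  · exact congrArg Prod.fst this
  intro u _
  refine ⟨fun x => ‖u‖ + (‖θ x‖ * ‖u‖ + ‖θ x u‖ + ‖fderiv ℝ θ x u - θ x u • θ x‖), ?_,
    fun x hx => ?_⟩
  · exact continuousOn_const.add (((hθc.norm.mul continuousOn_const).add
      (hθc.clm_apply continuousOn_const).norm).add ((hθc'.clm_apply continuousOn_const).sub
        ((hθc.clm_apply continuousOn_const).smul hθc)).norm)
  · have e : fderiv ℝ (fderiv ℝ c) x u = fderiv ℝ c x u • θ x + θ x u • fderiv ℝ c x +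
        c x • (fderiv ℝ θ x u - θ x u • θ x) := by
      ext y
      rw [(h.fderiv_scalar_and_hessian hV hx hy₀).2 u y]
      simp [quad]
      ring
    have n1 : ‖c x‖ ≤ ‖(c x, fderiv ℝ c x)‖ := norm_fst_le (c x, fderiv ℝ c x)
    have n2 : ‖fderiv ℝ c x‖ ≤ ‖(c x, fderiv ℝ c x)‖ := norm_snd_le (c x, fderiv ℝ c x)
    have n3 : ‖fderiv ℝ c x u‖ ≤ ‖(c x, fderiv ℝ c x)‖ * ‖u‖ :=
      ((fderiv ℝ c x).le_opNorm u).trans (mul_le_mul_of_nonneg_right n2 (norm_nonneg _))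
    set N := ‖(c x, fderiv ℝ c x)‖
    have hN : 0 ≤ N := norm_nonneg _
    have n4 : ‖fderiv ℝ (fderiv ℝ c) x u‖ ≤
        N * ‖u‖ * ‖θ x‖ + ‖θ x u‖ * N + N * ‖fderiv ℝ θ x u - θ x u • θ x‖ := by
      rw [e]
      refine (norm_add₃_le).trans ?_
      rw [norm_smul, norm_smul, norm_smul]
      gcongr
    refine (norm_prod_le_iff.mpr ⟨?_, ?_⟩)
    · refine n3.trans ?_
      have : 0 ≤ (‖θ x‖ * ‖u‖ + ‖θ x u‖ + ‖fderiv ℝ θ x u - θ x u • θ x‖) * N := by positivity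
      linarith
    · refine n4.trans ?_
      have : 0 ≤ ‖u‖ * N := by positivity
      linarith

/-- At x₀ both dc and D²c vanish, so the Hessian formula leaves c·q = 0. Either c(x₀) = 0 and the
1-jet is zero, or q = 0 and hence τ(x₀) = 0. -/
theorem eq_const_of_eventually_eq (h : FlatSystem B F c θ) (hB : Convex ℝ B)
    (hV : 1 < Module.rank ℝ V) {x₀ : V} (hx₀ : x₀ ∈ B) (h0 : ∀ᶠ x in 𝓝 x₀, c x = c x₀)
    {x : V} (hx : x ∈ B) : c x = c x₀ := by
  obtain ⟨y₀, hy₀, -⟩ := exists_ne_zero_apply_eq_zero hV (0 : V →L[ℝ] ℝ)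
  have hc' : ∀ᶠ x in 𝓝 x₀, fderiv ℝ c x = 0 := by
    filter_upwards [h0.eventually_nhds] with z hz
    rw [Filter.EventuallyEq.fderiv_eq (f₁ := c) (f := fun _ => c x₀) hz, fderiv_const_apply]
  by_cases hc : c x₀ = 0
  · rw [hc]
    exact h.eq_zero_of_eventually_eq_zero hB hV hx₀ hy₀ hc hc'.self_of_nhds hx
  · refine h.eq_const_of_scalar_eq_zero hB hV hx₀ hy₀ ?_ hx
    have h2 : fderiv ℝ (fderiv ℝ c) x₀ = 0 := by
      rw [Filter.EventuallyEq.fderiv_eq (f₁ := fderiv ℝ c) (f := fun _ => 0) hc',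
        fderiv_const_apply]
    have h3 := (h.fderiv_scalar_and_hessian hV hx₀ hy₀).2 y₀ y₀
    rw [h2, hc'.self_of_nhds] at h3
    have h4 : quad θ x₀ y₀ y₀ = 0 := by simpa [hc] using h3.symm
    simp [scalar, h4, hc'.self_of_nhds]

/-- Completing the square: (F − 2c₀/τ)² = q/τ + 4c₀²/τ². The linear term 2c₀/τ is the odd part of F,
so the root is the even part, which is positive. -/
theorem isRandersNorm (h : FlatSystem B F c θ) (hB : Convex ℝ B)
    (hV : 1 < Module.rank ℝ V) {x : V} (hx : x ∈ B) (h0 : ¬ ∀ᶠ z in 𝓝 x, c z = c x) :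
    IsRandersNorm (F x) := by
  obtain ⟨y₀, hy₀, -⟩ := exists_ne_zero_apply_eq_zero hV (0 : V →L[ℝ] ℝ)
  have hτ : scalar F c θ y₀ x ≠ 0 := fun hτ => h0 <| by
    filter_upwards [h.isOpen.mem_nhds hx] with z hz
    exact h.eq_const_of_scalar_eq_zero hB hV hx hy₀ hτ hz
  set τ := scalar F c θ y₀ x with hτd
  set a : V →L[ℝ] V →L[ℝ] ℝ := τ⁻¹ • (fderiv ℝ θ x - (θ x).smulRight (θ x)) +
    (4 * τ⁻¹ ^ 2) • (fderiv ℝ c x).smulRight (fderiv ℝ c x) with ha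
  have hav : ∀ v w, a v w = τ⁻¹ * quad θ x v w + 4 * τ⁻¹ ^ 2 * (fderiv ℝ c x v * fderiv ℝ c x w) :=
    fun v w => by simp [ha, quad]
  have hb : ∀ v, v ≠ 0 → 2 * τ⁻¹ * fderiv ℝ c x v = (F x v - F x (-v)) / 2 := by
    intro v hv
    have := h.fderiv_c_eq hV hx hv hy₀
    rw [← hτd] at this
    field_simp
    linarith
  have hsq : ∀ v, v ≠ 0 → a v v = ((F x v + F x (-v)) / 2) ^ 2 := by
    intro v hv
    have e1 := h.quadratic_equation hV hx hv hy₀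
    have e2 := hb v hv
    have e3 : (F x v + F x (-v)) / 2 = F x v - 2 * τ⁻¹ * fderiv ℝ c x v := by rw [e2]; ring
    rw [← hτd] at e1
    rw [hav, e3]
    have e4 : quad θ x v v = τ * F x v ^ 2 - 4 * fderiv ℝ c x v * F x v := by linarith
    rw [e4]
    field_simp
    ring
  have hp : ∀ v, v ≠ 0 → 0 < (F x v + F x (-v)) / 2 := fun v hv =>
    half_pos (add_pos (h.pos x hx v hv) (h.pos x hx _ (neg_ne_zero.mpr hv)))
  refine ⟨a, (2 * τ⁻¹) • fderiv ℝ c x, fun v w => ?_, fun v hv => ?_, fun v => ?_⟩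
  · rw [hav, hav, h.quad_symm hx v w, mul_comm (fderiv ℝ c x v)]
  · rw [hsq v hv]
    exact pow_pos (hp v hv) 2
  · rcases eq_or_ne v 0 with rfl | hv
    · simpa using h.homogeneous x hx 0 0 le_rfl
    · rw [hsq v hv, Real.sqrt_sq (hp v hv).le]
      simp only [smul_apply, smul_eq_mul, hb v hv]
      ring

end FlatSystem

/-! ### Local bounds for Finsler functions. -/

/-- `F(x, y)` is smooth for `y ≠ 0`, positive and positively homogeneous in `y`. -/
structure IsFinslerOn {V : Type*} [NormedAddCommGroup V] [NormedSpace ℝ V] (U : Set V)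
    (F : V → V → ℝ) : Prop where
  isOpen : IsOpen U
  smooth : ContDiffOn ℝ ∞ (fun z : V × V => F z.1 z.2) (U ×ˢ {0}ᶜ)
  pos : ∀ x ∈ U, ∀ y, y ≠ 0 → 0 < F x y
  homogeneous : ∀ x ∈ U, ∀ y, ∀ r : ℝ, 0 ≤ r → F x (r • y) = r * F x y

namespace IsFinslerOn

variable {V : Type*} [NormedAddCommGroup V] [NormedSpace ℝ V] {U : Set V} {F : V → V → ℝ}

theorem isOpen_prod (h : IsFinslerOn U F) : IsOpen (U ×ˢ ({0}ᶜ : Set V)) :=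
  h.isOpen.prod isOpen_compl_singleton

theorem contDiffAt (h : IsFinslerOn U F) {x y : V} (hx : x ∈ U) (hy : y ≠ 0) :
    ContDiffAt ℝ ∞ (fun z : V × V => F z.1 z.2) (x, y) :=
  h.smooth.contDiffAt (h.isOpen_prod.mem_nhds (mk_mem_prod hx hy))

theorem apply_zero (h : IsFinslerOn U F) {x : V} (hx : x ∈ U) : F x 0 = 0 := by
  simpa using h.homogeneous x hx 0 0 le_rfl

theorem hasFDerivAt_horizontal (h : IsFinslerOn U F) {x y : V} (hx : x ∈ U) (hy : y ≠ 0) :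
    HasFDerivAt (fun x => F x y) ((fderiv ℝ (fun z : V × V => F z.1 z.2) (x, y)).comp
      (ContinuousLinearMap.inl ℝ V V)) x := by
  have := ((h.contDiffAt hx hy).differentiableAt (by simp)).hasFDerivAt
  exact HasFDerivAt.comp (g := fun z : V × V => F z.1 z.2) (f := fun x => (x, y)) x this
    (hasFDerivAt_prodMk_left x y)

theorem fderiv_horizontal_smul (h : IsFinslerOn U F) {x : V} (hx : x ∈ U) (y : V)
    {r : ℝ} (hr : 0 ≤ r) : fderiv ℝ (fun x => F x (r • y)) x = r • fderiv ℝ (fun x => F x y) x := by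
  refine Eq.trans (Filter.EventuallyEq.fderiv_eq ?_)
    (congrFun (fderiv_const_smul_field r (f := fun x => F x y)) x)
  filter_upwards [h.isOpen.mem_nhds hx] with z hz
  simpa using h.homogeneous z hz y r hr

theorem continuousOn_fderiv_horizontal (h : IsFinslerOn U F) :
    ContinuousOn (fun z : V × V => fderiv ℝ (fun x => F x z.2) z.1) (U ×ˢ {0}ᶜ) := by
  have h1 := h.smooth.continuousOn_fderiv_of_isOpen h.isOpen_prod (by norm_cast)
  refine ((ContinuousLinearMap.compL ℝ V (V × V) ℝ).flip
    (ContinuousLinearMap.inl ℝ V V)).continuous.comp_continuousOn h1 |>.congr fun z hz => ?_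
  exact (h.hasFDerivAt_horizontal hz.1 hz.2).fderiv

theorem le_mul_norm_of_le_on_sphere {g : V → ℝ} {C : ℝ}
    (hg : ∀ y, y ≠ 0 → ∀ r : ℝ, 0 < r → g (r • y) = r * g y)
    (hC : ∀ y, ‖y‖ = 1 → g y ≤ C) {y : V} (hy : y ≠ 0) : g y ≤ C * ‖y‖ := by
  have hn : 0 < ‖y‖ := norm_pos_iff.mpr hy
  have h1 := hC (‖y‖⁻¹ • y) (by simp [norm_smul, hn.ne'])
  rw [hg y hy _ (inv_pos.mpr hn), inv_mul_le_iff₀ hn] at h1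
  linarith

/-- Uniform bounds for `F` and `∂F/∂x` near a point. -/
theorem exists_bounds [FiniteDimensional ℝ V] [Nontrivial V] (h : IsFinslerOn U F) {x₀ : V}
    (hx₀ : x₀ ∈ U) : ∃ r > 0, ∃ a > 0, ∃ C, 0 ≤ C ∧ Metric.closedBall x₀ r ⊆ U ∧
      ∀ x ∈ Metric.closedBall x₀ r, ∀ y,
        a * ‖y‖ ≤ F x y ∧ F x y ≤ C * ‖y‖ ∧ ‖fderiv ℝ (fun x => F x y) x‖ ≤ C * ‖y‖ := by
  obtain ⟨r, hr, hrU⟩ := Metric.nhds_basis_closedBall.mem_iff.mp (h.isOpen.mem_nhds hx₀)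
  have hK : IsCompact (Metric.closedBall x₀ r ×ˢ Metric.sphere (0 : V) 1) :=
    (isCompact_closedBall x₀ r).prod (isCompact_sphere 0 1)
  have hsub : Metric.closedBall x₀ r ×ˢ Metric.sphere (0 : V) 1 ⊆ U ×ˢ {0}ᶜ := by
    refine prod_mono hrU fun y hy => ?_
    have : ‖y‖ = 1 := by simpa using hy
    exact norm_ne_zero_iff.mp (by rw [this]; exact one_ne_zero)
  have hne : (Metric.closedBall x₀ r ×ˢ Metric.sphere (0 : V) 1).Nonempty :=
    (Metric.nonempty_closedBall.mpr hr.le).prod (NormedSpace.sphere_nonempty.mpr zero_le_one)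
  have hFc := h.smooth.continuousOn.mono hsub
  obtain ⟨⟨x₁, y₁⟩, hz₁, hmin⟩ := hK.exists_isMinOn hne hFc
  obtain ⟨C₁, hC₁⟩ := hK.bddAbove_image hFc
  obtain ⟨C₂, hC₂⟩ := hK.bddAbove_image (h.continuousOn_fderiv_horizontal.mono hsub).norm
  refine ⟨r, hr, F x₁ y₁, h.pos _ (hsub hz₁).1 _ (hsub hz₁).2, max 0 (max C₁ C₂),
    le_max_left _ _, hrU, fun x hx y => ?_⟩
  rcases eq_or_ne y 0 with rfl | hy
  · have e : fderiv ℝ (fun x => F x 0) x = 0 := by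
      simpa using h.fderiv_horizontal_smul (hrU hx) (0 : V) (le_refl (0 : ℝ))
    simp [h.apply_zero (hrU hx), e]
  have hs : ∀ y : V, ‖y‖ = 1 → (x, y) ∈ Metric.closedBall x₀ r ×ˢ Metric.sphere (0 : V) 1 :=
    fun y hy => ⟨hx, by simpa using hy⟩
  refine ⟨?_, ?_, ?_⟩
  · have := le_mul_norm_of_le_on_sphere (g := fun y => - F x y) (C := - F x₁ y₁)
      (fun y _ r hr => by simp [h.homogeneous x (hrU hx) y r hr.le])
      (fun y hy => neg_le_neg (hmin (hs y hy))) hy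
    linarith
  · exact le_mul_norm_of_le_on_sphere (fun y _ r hr => h.homogeneous x (hrU hx) y r hr.le)
      (fun y hy => (hC₁ (mem_image_of_mem _ (hs y hy))).trans
        ((le_max_left _ _).trans (le_max_right _ _))) hy
  · refine le_mul_norm_of_le_on_sphere (g := fun y => ‖fderiv ℝ (fun x => F x y) x‖)
      (fun y _ r hr => ?_)
      (fun y hy => (hC₂ (mem_image_of_mem _ (hs y hy))).trans
        ((le_max_right _ _).trans (le_max_right _ _))) hy
    rw [h.fderiv_horizontal_smul (hrU hx) y hr.le, norm_smul, Real.norm_of_nonneg hr.le]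

theorem continuous [FiniteDimensional ℝ V] [Nontrivial V] (h : IsFinslerOn U F) {x : V}
    (hx : x ∈ U) : Continuous (F x) := by
  refine continuous_iff_continuousAt.mpr fun y => ?_
  rcases eq_or_ne y 0 with rfl | hy
  · obtain ⟨r, hr, a, ha, C, hC, -, hb⟩ := h.exists_bounds hx
    have hxr : x ∈ Metric.closedBall x r := Metric.mem_closedBall_self hr.le
    rw [ContinuousAt, h.apply_zero hx]
    refine squeeze_zero (fun y => (by positivity : 0 ≤ a * ‖y‖).trans (hb x hxr y).1)
      (fun y => (hb x hxr y).2.1) ?_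
    have : Filter.Tendsto (fun y : V => C * ‖y‖) (𝓝 0) (𝓝 (C * ‖(0 : V)‖)) :=
      (continuous_const.mul continuous_norm).tendsto 0
    simpa using this
  · exact ContinuousAt.comp (g := fun z : V × V => F z.1 z.2) (f := fun y => (x, y))
      (h.contDiffAt hx hy).continuousAt (by fun_prop)

end IsFinslerOn

/-! ### Differentiability of the Busemann–Hausdorff density. -/

section Volume

variable {V : Type*} [NormedAddCommGroup V] [NormedSpace ℝ V] [FiniteDimensional ℝ V]
  [MeasurableSpace V] [BorelSpace V] (μ : Measure V) [μ.IsAddHaarMeasure]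

open scoped Pointwise in
theorem measure_lt_eq_of_homogeneous {N : V → ℝ}
    (hN : ∀ y, ∀ r : ℝ, 0 ≤ r → N (r • y) = r * N y) {s : ℝ} (hs : 0 < s) :
    μ {y | N y < s} = ENNReal.ofReal s ^ Module.finrank ℝ V * μ {y | N y < 1} := by
  have : {y | N y < s} = s • {y | N y < 1} := by
    ext y
    rw [mem_smul_set_iff_inv_smul_mem₀ hs.ne', mem_ofPred_eq, mem_ofPred_eq,
      hN y _ (inv_nonneg.mpr hs.le), inv_mul_lt_iff₀ hs, mul_one]
  rw [this, Measure.addHaar_smul, abs_of_nonneg (by positivity), ENNReal.ofReal_pow hs.le]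

/-- Layer cake: {t < exp(−N)} is {N < −log t}, a dilate of the unit ball by −log t if t < 1 and
empty if t ≥ 1. -/
theorem lintegral_exp_neg_of_homogeneous [Nontrivial V] {N : V → ℝ} (hc : Continuous N)
    (h0 : ∀ y, 0 ≤ N y) (hN : ∀ y, ∀ r : ℝ, 0 ≤ r → N (r • y) = r * N y) :
    ∫⁻ y, ENNReal.ofReal (Real.exp (-N y)) ∂μ =
      (∫⁻ t in Ioi (0 : ℝ), ENNReal.ofReal (-Real.log t) ^ Module.finrank ℝ V)
        * μ {y | N y < 1} := by
  have hd : Module.finrank ℝ V ≠ 0 := Module.finrank_pos.ne'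
  rw [lintegral_eq_lintegral_meas_lt μ (ae_of_all _ fun y => (Real.exp_pos _).le)
    (by fun_prop), ← lintegral_mul_const _ (by fun_prop)]
  refine setLIntegral_congr_fun measurableSet_Ioi fun t ht => ?_
  have e : {y | t < Real.exp (-N y)} = {y | N y < -Real.log t} := by
    ext y
    rw [mem_ofPred_eq, mem_ofPred_eq, ← Real.log_lt_iff_lt_exp ht, lt_neg]
  simp only [e]
  rcases lt_or_ge 0 (-Real.log t) with hs | hs
  · exact measure_lt_eq_of_homogeneous μ hN hs
  · have : {y | N y < -Real.log t} = ∅ := by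
      ext y
      simpa using hs.trans (h0 y)
    rw [this, ENNReal.ofReal_of_nonpos hs, zero_pow hd]
    simp

theorem integrable_norm_pow_mul_exp_neg [Nontrivial V] (k : ℕ) {a : ℝ} (ha : 0 < a) :
    Integrable (fun y : V => ‖y‖ ^ k * Real.exp (-(a * ‖y‖))) μ := by
  rw [integrable_fun_norm_addHaar μ (f := fun t : ℝ => t ^ k * Real.exp (-(a * t)))]
  have := integrableOn_rpow_mul_exp_neg_mul_rpow (p := 1)
    (s := ((Module.finrank ℝ V - 1 + k : ℕ) : ℝ)) (b := a)
    (lt_of_lt_of_le (by norm_num) (Nat.cast_nonneg _)) one_pos ha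
  refine this.congr_fun (fun t ht => ?_) measurableSet_Ioi
  simp only [Real.rpow_natCast, Real.rpow_one, smul_eq_mul, pow_add]
  rw [neg_mul, mul_assoc]

theorem integrable_exp_neg [Nontrivial V] {N : V → ℝ} (hc : Continuous N) {a : ℝ} (ha : 0 < a)
    (h : ∀ y, a * ‖y‖ ≤ N y) : Integrable (fun y => Real.exp (-N y)) μ := by
  have := integrable_norm_pow_mul_exp_neg μ 0 ha
  refine this.mono' (by fun_prop) (ae_of_all _ fun y => ?_)
  rw [Real.norm_of_nonneg (Real.exp_pos _).le, pow_zero, one_mul]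
  exact Real.exp_le_exp.mpr (neg_le_neg (h y))

/-- This replaces the volume of the moving domain {F < 1} by an integral over a fixed space, which
can be differentiated in x. The constant depends only on V and μ; its positivity is read off from N
= ‖·‖. -/
theorem exists_integral_exp_neg_eq [Nontrivial V] : ∃ K : ℝ, 0 < K ∧ ∀ N : V → ℝ, Continuous N →
    (∀ y, ∀ r : ℝ, 0 ≤ r → N (r • y) = r * N y) → (∃ a > 0, ∀ y, a * ‖y‖ ≤ N y) →
    ∫ y, Real.exp (-N y) ∂μ = K * (μ {y | N y < 1}).toReal := by
  set K := ∫⁻ t in Ioi (0 : ℝ), ENNReal.ofReal (-Real.log t) ^ Module.finrank ℝ V with hK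
  have main : ∀ N : V → ℝ, Continuous N →
    (∀ y, ∀ r : ℝ, 0 ≤ r → N (r • y) = r * N y) → (∃ a > 0, ∀ y, a * ‖y‖ ≤ N y) →
    ∫ y, Real.exp (-N y) ∂μ = K.toReal * (μ {y | N y < 1}).toReal := by
    rintro N hc hN ⟨a, ha, hab⟩
    rw [integral_eq_lintegral_of_nonneg_ae (ae_of_all _ fun y => (Real.exp_pos _).le)
      (by fun_prop), lintegral_exp_neg_of_homogeneous μ hc
      (fun y => (by positivity : 0 ≤ a * ‖y‖).trans (hab y)) hN, ENNReal.toReal_mul]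
  refine ⟨K.toReal, ?_, main⟩
  have h1 := main (fun y => ‖y‖) continuous_norm
    (fun y r hr => by rw [norm_smul, Real.norm_of_nonneg hr]) ⟨1, one_pos, fun y => by simp⟩
  have h2 : 0 < ∫ y : V, Real.exp (-‖y‖) ∂μ :=
    integral_exp_pos (integrable_exp_neg μ continuous_norm one_pos fun y => by simp)
  rw [h1] at h2
  exact pos_of_mul_pos_left h2 ENNReal.toReal_nonneg

theorem IsFinslerOn.differentiableAt_integral_exp_neg [Nontrivial V] {U : Set V} {F : V → V → ℝ}
    (h : IsFinslerOn U F) {x₀ : V} (hx₀ : x₀ ∈ U) :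
    DifferentiableAt ℝ (fun x => ∫ y, Real.exp (-F x y) ∂μ) x₀ := by
  obtain ⟨r, hr, a, ha, C, hC, hrU, hb⟩ := h.exists_bounds hx₀
  have hx₀r : x₀ ∈ Metric.closedBall x₀ r := Metric.mem_closedBall_self hr.le
  have := hasFDerivAt_integral_of_dominated_of_fderiv_le (μ := μ) (𝕜 := ℝ) (x₀ := x₀)
    (s := Metric.closedBall x₀ r) (F := fun x y => Real.exp (-F x y))
    (F' := fun x y => Real.exp (-F x y) • -fderiv ℝ (fun x => F x y) x)
    (bound := fun y => C * (‖y‖ ^ 1 * Real.exp (-(a * ‖y‖))))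
    (Metric.closedBall_mem_nhds x₀ hr) ?_ ?_ ?_ ?_ ?_ ?_
  · exact this.differentiableAt
  · filter_upwards [h.isOpen.mem_nhds hx₀] with x hx
    have := h.continuous hx
    fun_prop
  · exact integrable_exp_neg μ (h.continuous hx₀) ha fun y => (hb x₀ hx₀r y).1
  · have h1 := h.continuous hx₀
    have h2 : ContinuousOn (fun y => fderiv ℝ (fun x => F x y) x₀) {0}ᶜ :=
      h.continuousOn_fderiv_horizontal.comp (f := fun y : V => (x₀, y)) (by fun_prop)
        fun y hy => ⟨hx₀, hy⟩
    have h3 := (h2.neg.aestronglyMeasurable (μ := μ)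
      (measurableSet_singleton (0 : V)).compl)
    rw [restrict_compl_singleton] at h3
    exact AEStronglyMeasurable.smul (Real.continuous_exp.comp h1.neg).aestronglyMeasurable h3
  · refine ae_of_all _ fun y x hx => ?_
    rw [norm_smul, norm_neg, Real.norm_of_nonneg (Real.exp_pos _).le]
    calc _ ≤ Real.exp (-(a * ‖y‖)) * (C * ‖y‖) :=
          mul_le_mul (Real.exp_le_exp.mpr (neg_le_neg (hb x hx y).1)) (hb x hx y).2.2
            (norm_nonneg _) (Real.exp_pos _).le
      _ = _ := by ring
  · exact (integrable_norm_pow_mul_exp_neg μ 1 ha).const_mul C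
  -- F is smooth only off the zero section; the origin is a null set.
  · have h0 : ∀ᵐ y ∂μ, y ≠ 0 := by simp [ae_iff]
    filter_upwards [h0] with y hy x hx
    have := (h.hasFDerivAt_horizontal (hrU hx) hy)
    rw [← this.fderiv] at this
    exact this.neg.exp

theorem IsFinslerOn.differentiableAt_log_measure [Nontrivial V] {U : Set V} {F : V → V → ℝ}
    (h : IsFinslerOn U F) {x₀ : V} (hx₀ : x₀ ∈ U) (C : ℝ) :
    DifferentiableAt ℝ (fun x => Real.log (C / (μ {y | F x y < 1}).toReal)) x₀ := by
  rcases eq_or_ne C 0 with rfl | hC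
  · simp
  obtain ⟨K, hK, hKN⟩ := exists_integral_exp_neg_eq μ
  have e : ∀ x ∈ U, ∫ y, Real.exp (-F x y) ∂μ = K * (μ {y | F x y < 1}).toReal := by
    intro x hx
    obtain ⟨r, hr, a, ha, C, hC, -, hb⟩ := h.exists_bounds hx
    exact hKN _ (h.continuous hx) (h.homogeneous x hx)
      ⟨a, ha, fun y => (hb x (Metric.mem_closedBall_self hr.le) y).1⟩
  have hpos : 0 < ∫ y, Real.exp (-F x₀ y) ∂μ := by
    obtain ⟨r, hr, a, ha, C, hC, -, hb⟩ := h.exists_bounds hx₀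
    exact integral_exp_pos (integrable_exp_neg μ (h.continuous hx₀) ha
      fun y => (hb x₀ (Metric.mem_closedBall_self hr.le) y).1)
  have hd := h.differentiableAt_integral_exp_neg μ hx₀
  have h1 : DifferentiableAt ℝ
      (fun x => Real.log ((C * K) / ∫ y, Real.exp (-F x y) ∂μ)) x₀ :=
    (((hd.inv hpos.ne').const_mul (C * K)).congr_of_eventuallyEq
      (.of_eq (funext fun _ => div_eq_mul_inv _ _))).log
      (div_ne_zero (mul_ne_zero hC hK.ne') hpos.ne')
  refine h1.congr_of_eventuallyEq ?_
  filter_upwards [h.isOpen.mem_nhds hx₀] with x hx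
  rw [e x hx, mul_comm C K, mul_div_mul_left _ _ hK.ne']

end Volume

/-! ### Partial derivatives, determinants and inverses in coordinates. -/

section Coordinates

variable {n : ℕ} {f : E n → E n → ℝ} {Ω : Set (E n × E n)}

theorem dX_eq {x y : E n} (hf : DifferentiableAt ℝ (fun z : E n × E n => f z.1 z.2) (x, y))
    (k : Fin n) : dX f k x y =
      fderiv ℝ (fun z : E n × E n => f z.1 z.2) (x, y) (EuclideanSpace.single k 1, 0) := by
  have := HasFDerivAt.comp (g := fun z : E n × E n => f z.1 z.2) (f := fun x => (x, y)) x
    hf.hasFDerivAt (hasFDerivAt_prodMk_left x y)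
  exact congrArg (fun L => L (EuclideanSpace.single k 1)) this.fderiv

theorem dY_eq {x y : E n} (hf : DifferentiableAt ℝ (fun z : E n × E n => f z.1 z.2) (x, y))
    (k : Fin n) : dY f k x y =
      fderiv ℝ (fun z : E n × E n => f z.1 z.2) (x, y) (0, EuclideanSpace.single k 1) := by
  have := HasFDerivAt.comp (g := fun z : E n × E n => f z.1 z.2) (f := fun y => (x, y)) y
    hf.hasFDerivAt (hasFDerivAt_prodMk_right x y)
  exact congrArg (fun L => L (EuclideanSpace.single k 1)) this.fderiv

theorem differentiableAt_of_contDiffOn (hΩ : IsOpen Ω)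
    (hf : ContDiffOn ℝ ∞ (fun z : E n × E n => f z.1 z.2) Ω) {z : E n × E n} (hz : z ∈ Ω) :
    DifferentiableAt ℝ (fun z : E n × E n => f z.1 z.2) z :=
  (hf.contDiffAt (hΩ.mem_nhds hz)).differentiableAt (by simp)

theorem contDiffOn_dX (hΩ : IsOpen Ω) (hf : ContDiffOn ℝ ∞ (fun z : E n × E n => f z.1 z.2) Ω)
    (k : Fin n) : ContDiffOn ℝ ∞ (fun z : E n × E n => dX f k z.1 z.2) Ω :=
  ((hf.fderiv_of_isOpen hΩ (m := ∞) (by simp)).clm_apply contDiffOn_const).congr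
    fun _ hz => dX_eq (differentiableAt_of_contDiffOn hΩ hf hz) k

theorem contDiffOn_dY (hΩ : IsOpen Ω) (hf : ContDiffOn ℝ ∞ (fun z : E n × E n => f z.1 z.2) Ω)
    (k : Fin n) : ContDiffOn ℝ ∞ (fun z : E n × E n => dY f k z.1 z.2) Ω :=
  ((hf.fderiv_of_isOpen hΩ (m := ∞) (by simp)).clm_apply contDiffOn_const).congr
    fun _ hz => dY_eq (differentiableAt_of_contDiffOn hΩ hf hz) k

/-- The second derivative as an iterated partial derivative. -/
theorem fderiv_dY (hΩ : IsOpen Ω) (hf : ContDiffOn ℝ ∞ (fun z : E n × E n => f z.1 z.2) Ω)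
    (k : Fin n) {z : E n × E n} (hz : z ∈ Ω) (v : E n × E n) :
    fderiv ℝ (fun z : E n × E n => dY f k z.1 z.2) z v =
      fderiv ℝ (fderiv ℝ (fun z : E n × E n => f z.1 z.2)) z v
        (0, EuclideanSpace.single k 1) := by
  have h1 : HasFDerivAt (fderiv ℝ (fun z : E n × E n => f z.1 z.2)) _ z :=
    (((hf.contDiffAt (hΩ.mem_nhds hz)).fderiv_right (m := 1) (by norm_cast)).differentiableAt
      (by simp)).hasFDerivAt
  have h2 := h1.clm_apply
    (hasFDerivAt_const ((0, EuclideanSpace.single k 1) : E n × E n) z)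
  have h3 := h2.congr_of_eventuallyEq (f₁ := fun z : E n × E n => dY f k z.1 z.2) (by
    filter_upwards [hΩ.mem_nhds hz] with w hw
    exact dY_eq (differentiableAt_of_contDiffOn hΩ hf hw) k)
  rw [h3.fderiv]
  simp

theorem ContDiffOn.matrix_det {X : Type*} [NormedAddCommGroup X] [NormedSpace ℝ X] {s : Set X}
    {A : X → Matrix (Fin n) (Fin n) ℝ} (hA : ∀ i j, ContDiffOn ℝ ∞ (fun z => A z i j) s) :
    ContDiffOn ℝ ∞ (fun z => (A z).det) s := by
  simp only [Matrix.det_apply]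
  exact ContDiffOn.sum fun σ _ => (contDiffOn_prod fun i _ => hA _ _).const_smul _

theorem ContDiffOn.matrix_inv {X : Type*} [NormedAddCommGroup X] [NormedSpace ℝ X] {s : Set X}
    {A : X → Matrix (Fin n) (Fin n) ℝ} (hA : ∀ i j, ContDiffOn ℝ ∞ (fun z => A z i j) s)
    (h0 : ∀ z ∈ s, (A z).det ≠ 0) (i j : Fin n) :
    ContDiffOn ℝ ∞ (fun z => (A z)⁻¹ i j) s := by
  simp only [Matrix.inv_def, Ring.inverse_eq_inv', Matrix.smul_apply, Matrix.adjugate_apply,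
    smul_eq_mul]
  refine ((ContDiffOn.matrix_det hA).inv h0).mul (ContDiffOn.matrix_det fun k l => ?_)
  by_cases hk : k = j
  · subst hk
    simp only [Matrix.updateRow_self]
    exact contDiffOn_const
  · simp only [Matrix.updateRow_ne hk]
    exact hA k l

theorem sum_smul_single_one (y : E n) : ∑ k, y k • EuclideanSpace.single k (1 : ℝ) = y := by
  ext i
  simp [Finset.sum_apply, Pi.single_apply]

theorem sum_apply_single_mul (L : E n →L[ℝ] ℝ) (y : E n) :
    ∑ k, L (EuclideanSpace.single k 1) * y k = L y := by
  conv_rhs => rw [← sum_smul_single_one y, map_sum]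
  exact Finset.sum_congr rfl fun k _ => by rw [map_smul, smul_eq_mul, mul_comm]

end Coordinates

/-! ### Straight geodesics force radial geodesic coefficients. -/

namespace IsFinslerOn

variable {n : ℕ} {U : Set (E n)} {F : E n → E n → ℝ}

theorem contDiffOn_energy (h : IsFinslerOn U F) :
    ContDiffOn ℝ ∞ (fun z : E n × E n => energy F z.1 z.2) (U ×ˢ {0}ᶜ) :=
  h.smooth.pow 2

theorem contDiffOn_fundamentalTensor (h : IsFinslerOn U F) (i j : Fin n) :
    ContDiffOn ℝ ∞ (fun z : E n × E n => fundamentalTensor F z.1 z.2 i j) (U ×ˢ {0}ᶜ) := by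
  simp only [fundamentalTensor, Matrix.of_apply]
  exact contDiffOn_const.mul
    (contDiffOn_dY h.isOpen_prod (contDiffOn_dY h.isOpen_prod h.contDiffOn_energy i) j)

theorem contDiffOn_geodesicCoeff (h : IsFinslerOn U F)
    (hpd : ∀ x ∈ U, ∀ y, y ≠ 0 → (fundamentalTensor F x y).PosDef) (i : Fin n) :
    ContDiffOn ℝ ∞ (fun z : E n × E n => geodesicCoeff F i z.1 z.2) (U ×ˢ {0}ᶜ) := by
  have hy := contDiffOn_dY h.isOpen_prod h.contDiffOn_energy
  have hinv := ContDiffOn.matrix_inv h.contDiffOn_fundamentalTensor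
    (fun z hz => (hpd z.1 hz.1 z.2 hz.2).det_pos.ne')
  simp only [geodesicCoeff]
  refine contDiffOn_const.mul (ContDiffOn.sum fun l _ => (hinv i l).mul
    ((ContDiffOn.sum fun m _ => (contDiffOn_dX h.isOpen_prod (hy l) m).mul ?_).sub
      (contDiffOn_dX h.isOpen_prod h.contDiffOn_energy l)))
  have : ContDiff ℝ ∞ (fun z : E n × E n => z.2 m) := by fun_prop
  exact this.contDiffOn

theorem mem_span_of_forall_mem {γ : ℝ → E n} {v : E n} {S : Submodule ℝ (E n)} {t : ℝ}
    (hγ : HasDerivAt γ v t) (hS : ∀ᶠ s in 𝓝 t, γ s ∈ S) : v ∈ S := by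
  have hcl : S.orthogonalᗮ = S := Submodule.orthogonal_orthogonal S
  rw [← hcl, Submodule.mem_orthogonal]
  intro u hu
  have h1 := (innerSL ℝ u).hasFDerivAt.comp_hasDerivAt t hγ
  have h2 : HasDerivAt (innerSL ℝ u ∘ γ) 0 t := by
    refine (hasDerivAt_const t (0 : ℝ)).congr_of_eventuallyEq ?_
    filter_upwards [hS] with s hs
    exact (Submodule.mem_orthogonal' S u).mp hu _ hs
  exact h1.unique h2

/-- For a projectively flat metric the geodesic coefficients are radial. -/
theorem exists_geodesicCoeff_eq (h : IsFinslerOn U F)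
    (hpd : ∀ x ∈ U, ∀ y, y ≠ 0 → (fundamentalTensor F x y).PosDef)
    (hflat : IsProjectivelyFlatOn F U) {x y : E n} (hx : x ∈ U) (hy : y ≠ 0) :
    ∃ P : ℝ, ∀ i, geodesicCoeff F i x y = P * y i := by
  -- The geodesic equation as a first-order field on pairs (position, velocity); it is C¹ near (x,
  -- y), so a geodesic with these initial data exists.
  set Φ : E n × E n → E n × E n := fun z =>
    (z.2, WithLp.toLp 2 fun i => -(2 * geodesicCoeff F i z.1 z.2)) with hΦ
  have hΦc : ContDiffAt ℝ 1 Φ (x, y) := by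
    refine contDiffAt_snd.prodMk ?_
    rw [contDiffAt_euclidean]
    intro i
    have := (h.contDiffOn_geodesicCoeff hpd i).contDiffAt
      (h.isOpen_prod.mem_nhds (mk_mem_prod hx hy))
    exact (contDiffAt_const.mul (this.of_le (by norm_cast))).neg
  obtain ⟨r, hr, ε, hε, hsol⟩ :=
    hΦc.exists_forall_mem_closedBall_exists_eq_forall_mem_Ioo_hasDerivAt 0
  obtain ⟨α, hα0, hα⟩ := hsol (x, y) (Metric.mem_closedBall_self hr.le)
  simp only [zero_sub, zero_add] at hα
  have hα1 : ∀ t ∈ Ioo (-ε) ε, HasDerivAt (fun t => (α t).1) (α t).2 t := fun t ht =>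
    (ContinuousLinearMap.fst ℝ (E n) (E n)).hasFDerivAt.comp_hasDerivAt t (hα t ht)
  have hα2 : ∀ t ∈ Ioo (-ε) ε, HasDerivAt (fun t => (α t).2) (Φ (α t)).2 t := fun t ht =>
    (ContinuousLinearMap.snd ℝ (E n) (E n)).hasFDerivAt.comp_hasDerivAt t (hα t ht)
  have hmem : ∀ᶠ t in 𝓝 (0 : ℝ), α t ∈ U ×ˢ ({0}ᶜ : Set (E n)) := by
    refine (hα 0 ⟨by linarith, hε⟩).continuousAt.eventually_mem ?_
    rw [hα0]
    exact h.isOpen_prod.mem_nhds (mk_mem_prod hx hy)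
  obtain ⟨δ, hδ, hδm⟩ := Metric.eventually_nhds_iff_ball.mp hmem
  set ρ := min δ ε with hρ
  have hρ0 : 0 < ρ := lt_min hδ hε
  have hI : ∀ t ∈ Ioo (-ρ) ρ, t ∈ Ioo (-ε) ε ∧ α t ∈ U ×ˢ ({0}ᶜ : Set (E n)) := by
    intro t ht
    have h1 : ρ ≤ δ := min_le_left _ _
    have h2 : ρ ≤ ε := min_le_right _ _
    refine ⟨⟨by linarith [ht.1], by linarith [ht.2]⟩, hδm t ?_⟩
    rw [Real.ball_eq_Ioo]
    exact ⟨by linarith [ht.1], by linarith [ht.2]⟩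
  have hcol := hflat (-ρ) ρ (fun t => (α t).1) (fun t => (α t).2)
    { mem := fun t ht => (hI t ht).2.1
      regular := fun t ht => (hI t ht).2.2
      velocity := fun t ht => hα1 t (hI t ht).1
      equation := fun t ht i =>
        (EuclideanSpace.proj (𝕜 := ℝ) i).hasFDerivAt.comp_hasDerivAt t
          (hα2 t (hI t ht).1) }
  have h0 : (0 : ℝ) ∈ Ioo (-ρ) ρ := ⟨by linarith, hρ0⟩
  -- Displacements lie in the line spanned by w, hence so do velocity and acceleration: y = a w and
  -- −2G = b w at time 0, which gives P = −(b/a)/2.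
  obtain ⟨w, hw⟩ := (collinear_iff_of_mem (mem_image_of_mem (fun t => (α t).1) h0)).mp hcol
  have hpos : ∀ t ∈ Ioo (-ρ) ρ, (α t).1 - (α 0).1 ∈ Submodule.span ℝ {w} := by
    intro t ht
    obtain ⟨r, hr⟩ := hw _ (mem_image_of_mem _ ht)
    rw [Submodule.mem_span_singleton]
    exact ⟨r, by rw [hr]; simp⟩
  have hvel : ∀ t ∈ Ioo (-ρ) ρ, (α t).2 ∈ Submodule.span ℝ {w} := fun t ht =>
    mem_span_of_forall_mem ((hα1 t (hI t ht).1).sub_const (α 0).1)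
      (by filter_upwards [Ioo_mem_nhds ht.1 ht.2] with s hs using hpos s hs)
  have hacc : (Φ (α 0)).2 ∈ Submodule.span ℝ {w} :=
    mem_span_of_forall_mem (hα2 0 (hI 0 h0).1)
      (by filter_upwards [Ioo_mem_nhds h0.1 h0.2] with s hs using hvel s hs)
  have hv0 := hvel 0 h0
  rw [hα0] at hv0 hacc
  obtain ⟨a, ha⟩ := Submodule.mem_span_singleton.mp hv0
  obtain ⟨b, hb⟩ := Submodule.mem_span_singleton.mp hacc
  have ha0 : a ≠ 0 := fun h0 => hy (by rw [← show a • w = y from ha, h0, zero_smul])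
  refine ⟨-(b / a) / 2, fun i => ?_⟩
  have h1 : a * w i = y i := congrArg (fun v : E n => v i) ha
  have h2 : b * w i = -(2 * geodesicCoeff F i x y) := congrArg (fun v : E n => v i) hb
  rw [← h1]
  field_simp
  linarith

end IsFinslerOn

/-! ### The projective factor, the S-curvature and the derivation of the flat system. -/

namespace IsFinslerOn

variable {n : ℕ} {U : Set (E n)} {F : E n → E n → ℝ}

/-- The projective factor `P = F_{xᵏ} yᵏ / (2F)`. -/
def projectiveFactor (F : E n → E n → ℝ) (x y : E n) : ℝ :=
  fderiv ℝ (fun x => F x y) x y / (2 * F x y)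

theorem hasFDerivAt_of_contDiffOn {f : E n × E n → ℝ} (h : IsFinslerOn U F)
    (hf : ContDiffOn ℝ ∞ f (U ×ˢ {0}ᶜ)) {x y : E n} (hx : x ∈ U) (hy : y ≠ 0) :
    HasFDerivAt f (fderiv ℝ f (x, y)) (x, y) :=
  ((hf.contDiffAt (h.isOpen_prod.mem_nhds (mk_mem_prod hx hy))).differentiableAt
    (by simp)).hasFDerivAt

theorem hasFDerivAt_fderiv_of_contDiffOn {f : E n × E n → ℝ} (h : IsFinslerOn U F)
    (hf : ContDiffOn ℝ ∞ f (U ×ˢ {0}ᶜ)) {x y : E n} (hx : x ∈ U) (hy : y ≠ 0) :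
    HasFDerivAt (fderiv ℝ f) (fderiv ℝ (fderiv ℝ f) (x, y)) (x, y) :=
  (((hf.contDiffAt (h.isOpen_prod.mem_nhds (mk_mem_prod hx hy))).fderiv_right (m := 1)
    (by norm_cast)).differentiableAt (by simp)).hasFDerivAt

/-- Euler's relation. -/
theorem fderiv_self_of_homogeneous {f : E n → E n → ℝ} {x y : E n} {k : ℕ}
    {L : E n × E n →L[ℝ] ℝ} (hL : HasFDerivAt (fun z : E n × E n => f z.1 z.2) L (x, y))
    (hf : ∀ r : ℝ, 0 < r → f x (r • y) = r ^ k * f x y) : L (0, y) = k * f x y := by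
  have h1 : HasDerivAt (fun t : ℝ => (x, t • y)) ((0 : E n), y) 1 := by
    simpa using (hasDerivAt_const (1 : ℝ) x).prodMk ((hasDerivAt_id (1 : ℝ)).smul_const y)
  have h3 : HasFDerivAt (fun z : E n × E n => f z.1 z.2) L (x, (1 : ℝ) • y) := by simpa using hL
  have h2 : HasDerivAt (fun t : ℝ => f x (t • y)) (L (0, y)) 1 := by
    exact h3.comp_hasDerivAt (1 : ℝ) h1
  refine h2.unique ?_
  have : HasDerivAt (fun t : ℝ => t ^ k * f x y) (k * f x y) 1 := by
    simpa using (hasDerivAt_pow k (1 : ℝ)).mul_const (f x y)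
  refine this.congr_of_eventuallyEq ?_
  filter_upwards [lt_mem_nhds (zero_lt_one : (0 : ℝ) < 1)] with t ht
  exact hf t ht

theorem energy_smul (h : IsFinslerOn U F) {x : E n} (hx : x ∈ U) (y : E n) {r : ℝ} (hr : 0 < r) :
    energy F x (r • y) = r ^ 2 * energy F x y := by
  simp only [energy, h.homogeneous x hx y r hr.le]
  ring

theorem fderiv_energy_self (h : IsFinslerOn U F) {x y : E n} (hx : x ∈ U) (hy : y ≠ 0) :
    fderiv ℝ (fun z : E n × E n => energy F z.1 z.2) (x, y) (0, y) = 2 * energy F x y := by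
  have := fderiv_self_of_homogeneous (h.hasFDerivAt_of_contDiffOn h.contDiffOn_energy hx hy)
    (fun r hr => h.energy_smul hx y hr)
  exact_mod_cast this

theorem fderiv_fderiv_energy_self (h : IsFinslerOn U F) {x y : E n} (hx : x ∈ U) (hy : y ≠ 0)
    (a b : E n) :
    fderiv ℝ (fderiv ℝ (fun z : E n × E n => energy F z.1 z.2)) (x, y) (a, b) (0, y)
      + fderiv ℝ (fun z : E n × E n => energy F z.1 z.2) (x, y) (0, b) =
      2 * fderiv ℝ (fun z : E n × E n => energy F z.1 z.2) (x, y) (a, b) := by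
  have h1 := (h.hasFDerivAt_fderiv_of_contDiffOn h.contDiffOn_energy hx hy).clm_apply
    ((hasFDerivAt_const (0 : E n) (x, y)).prodMk (hasFDerivAt_snd (𝕜 := ℝ) (p := (x, y))))
  have h2 := (h.hasFDerivAt_of_contDiffOn h.contDiffOn_energy hx hy).const_mul 2
  have h3 := h2.congr_of_eventuallyEq (f₁ := fun z : E n × E n =>
    fderiv ℝ (fun z : E n × E n => energy F z.1 z.2) z (0, z.2)) (by
    filter_upwards [h.isOpen_prod.mem_nhds (mk_mem_prod hx hy)] with z hz
    exact h.fderiv_energy_self hz.1 hz.2)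
  have := congrArg (fun L : E n × E n →L[ℝ] ℝ => L (a, b)) (h1.unique h3)
  simp at this
  linarith

theorem fderiv_fderiv_energy_symm (h : IsFinslerOn U F) {x y : E n} (hx : x ∈ U) (hy : y ≠ 0)
    (v w : E n × E n) :
    fderiv ℝ (fderiv ℝ (fun z : E n × E n => energy F z.1 z.2)) (x, y) v w =
    fderiv ℝ (fderiv ℝ (fun z : E n × E n => energy F z.1 z.2)) (x, y) w v := by
  have := (h.contDiffOn_energy.contDiffAt
    (h.isOpen_prod.mem_nhds (mk_mem_prod hx hy))).isSymmSndFDerivAt (by simp; norm_cast)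
  exact this v w

theorem clm_ext_single {L L' : E n →L[ℝ] ℝ}
    (hL : ∀ k, L (EuclideanSpace.single k 1) = L' (EuclideanSpace.single k 1)) : L = L' := by
  ext u
  rw [← sum_apply_single_mul L, ← sum_apply_single_mul L']
  simp [hL]

open scoped Matrix in
/-- The equations for radial geodesic coefficients. -/
theorem energy_equation (h : IsFinslerOn U F)
    (hpd : ∀ x ∈ U, ∀ y, y ≠ 0 → (fundamentalTensor F x y).PosDef) {x y : E n} (hx : x ∈ U)
    (hy : y ≠ 0) {P : ℝ} (hP : ∀ i, geodesicCoeff F i x y = P * y i) (u : E n) :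
    2 * P * fderiv ℝ (fun z : E n × E n => energy F z.1 z.2) (x, y) (0, u) =
      fderiv ℝ (fderiv ℝ (fun z : E n × E n => energy F z.1 z.2)) (x, y) (y, 0) (0, u) -
      fderiv ℝ (fun z : E n × E n => energy F z.1 z.2) (x, y) (u, 0) := by
  set f : E n × E n → ℝ := fun z => energy F z.1 z.2 with hf
  have hz : (x, y) ∈ U ×ˢ ({0}ᶜ : Set (E n)) := mk_mem_prod hx hy
  have hd : DifferentiableAt ℝ f (x, y) :=
    differentiableAt_of_contDiffOn h.isOpen_prod h.contDiffOn_energy hz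
  have hd2 (l : Fin n) :=
    differentiableAt_of_contDiffOn h.isOpen_prod
      (contDiffOn_dY h.isOpen_prod h.contDiffOn_energy l) hz
  set R : Fin n → ℝ := fun l =>
    (∑ m, dX (dY (energy F) l) m x y * y m) - dX (energy F) l x y with hR
  have hG : fundamentalTensor F x y *ᵥ (fun i => P * y i) = fun l => (1 / 4 : ℝ) * R l := by
    have e : (fun i => P * y i) = (1 / 4 : ℝ) • ((fundamentalTensor F x y)⁻¹ *ᵥ R) := by
      ext i
      rw [← hP i, geodesicCoeff]
      rfl
    rw [e, Matrix.mulVec_smul, Matrix.mulVec_mulVec,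
      Matrix.mul_nonsing_inv _ (hpd x hx y hy).det_pos.ne'.isUnit, Matrix.one_mulVec]
    rfl
  have key : ∀ l : Fin n,
      2 * P * fderiv ℝ f (x, y) (0, EuclideanSpace.single l 1) =
        fderiv ℝ (fderiv ℝ f) (x, y) (y, 0) (0, EuclideanSpace.single l 1) -
        fderiv ℝ f (x, y) (EuclideanSpace.single l 1, 0) := by
    intro l
    have h1 := congrFun hG l
    have e1 : (fundamentalTensor F x y *ᵥ (fun i => P * y i)) l =
        P / 2 * fderiv ℝ (fderiv ℝ f) (x, y) (0, y) (0, EuclideanSpace.single l 1) := by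
      have := sum_apply_single_mul ((((fderiv ℝ (fderiv ℝ f) (x, y)).flip
        (0, EuclideanSpace.single l 1))).comp (ContinuousLinearMap.inr ℝ (E n) (E n))) y
      simp only [ContinuousLinearMap.comp_apply, ContinuousLinearMap.inr_apply,
        ContinuousLinearMap.flip_apply] at this
      rw [← this, Matrix.mulVec, dotProduct, Finset.mul_sum]
      refine Finset.sum_congr rfl fun j _ => ?_
      rw [fundamentalTensor, Matrix.of_apply, dY_eq (hd2 l) j,
        fderiv_dY h.isOpen_prod h.contDiffOn_energy l hz]
      ring
    have e2 : R l = fderiv ℝ (fderiv ℝ f) (x, y) (y, 0) (0, EuclideanSpace.single l 1) -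
        fderiv ℝ f (x, y) (EuclideanSpace.single l 1, 0) := by
      have := sum_apply_single_mul ((((fderiv ℝ (fderiv ℝ f) (x, y)).flip
        (0, EuclideanSpace.single l 1))).comp (ContinuousLinearMap.inl ℝ (E n) (E n))) y
      simp only [ContinuousLinearMap.comp_apply, ContinuousLinearMap.inl_apply,
        ContinuousLinearMap.flip_apply] at this
      simp only [hR]
      rw [← this, dX_eq hd l]
      congr 1
      refine Finset.sum_congr rfl fun j _ => ?_
      rw [dX_eq (hd2 l) j, fderiv_dY h.isOpen_prod h.contDiffOn_energy l hz]
    -- Euler's relation for F²: [F²]_{yʲyˡ}yʲ = [F²]_{yˡ}.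
    have e3 := h.fderiv_fderiv_energy_self hx hy 0 (EuclideanSpace.single l 1)
    rw [h.fderiv_fderiv_energy_symm hx hy] at e3
    rw [e1, e2] at h1
    linear_combination 4 * h1 - 2 * P * e3
  have hL : (2 * P) • (fderiv ℝ f (x, y)).comp (ContinuousLinearMap.inr ℝ (E n) (E n)) =
      (fderiv ℝ (fderiv ℝ f) (x, y) (y, 0)).comp (ContinuousLinearMap.inr ℝ (E n) (E n)) -
      (fderiv ℝ f (x, y)).comp (ContinuousLinearMap.inl ℝ (E n) (E n)) :=
    clm_ext_single fun k => by simpa using key k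
  simpa using congrArg (fun L : E n →L[ℝ] ℝ => L u) hL

theorem fderiv_energy (h : IsFinslerOn U F) {x y : E n} (hx : x ∈ U) (hy : y ≠ 0)
    (v : E n × E n) : fderiv ℝ (fun z : E n × E n => energy F z.1 z.2) (x, y) v =
      2 * F x y * fderiv ℝ (fun z : E n × E n => F z.1 z.2) (x, y) v := by
  have := (h.hasFDerivAt_of_contDiffOn h.smooth hx hy).pow 2
  rw [HasFDerivAt.fderiv (f := fun z : E n × E n => energy F z.1 z.2) this]
  simp

theorem fderiv_horizontal (h : IsFinslerOn U F) {x y : E n} (hx : x ∈ U) (hy : y ≠ 0) (u : E n) :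
    fderiv ℝ (fun x => F x y) x u =
      fderiv ℝ (fun z : E n × E n => F z.1 z.2) (x, y) (u, 0) := by
  rw [(h.hasFDerivAt_horizontal hx hy).fderiv]
  simp

theorem fderiv_energy_horizontal_self (h : IsFinslerOn U F) {x y : E n} (hx : x ∈ U)
    (hy : y ≠ 0) : fderiv ℝ (fun z : E n × E n => energy F z.1 z.2) (x, y) (y, 0) =
      4 * projectiveFactor F x y * energy F x y := by
  rw [h.fderiv_energy hx hy, projectiveFactor, h.fderiv_horizontal hx hy, energy]
  have := (h.pos x hx y hy).ne'
  field_simp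
  ring

/-- Taking u = y in `energy_equation` and applying Euler's relation identifies the unknown factor.
-/
theorem geodesicCoeff_eq (h : IsFinslerOn U F)
    (hpd : ∀ x ∈ U, ∀ y, y ≠ 0 → (fundamentalTensor F x y).PosDef)
    (hflat : IsProjectivelyFlatOn F U) {x y : E n} (hx : x ∈ U) (hy : y ≠ 0) (i : Fin n) :
    geodesicCoeff F i x y = projectiveFactor F x y * y i := by
  obtain ⟨P, hP⟩ := h.exists_geodesicCoeff_eq hpd hflat hx hy
  have h1 := h.energy_equation hpd hx hy hP y
  have h2 := h.fderiv_fderiv_energy_self hx hy y 0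
  rw [h.fderiv_energy_horizontal_self hx hy] at h1 h2
  rw [h.fderiv_energy_self hx hy] at h1
  rw [← Prod.zero_eq_mk, map_zero] at h2
  have hE : energy F x y ≠ 0 := pow_ne_zero 2 (h.pos x hx y hy).ne'
  rw [hP]
  congr 1
  refine mul_right_cancel₀ hE ?_
  linarith

theorem contDiffOn_projectiveFactor (h : IsFinslerOn U F) :
    ContDiffOn ℝ ∞ (fun z : E n × E n => projectiveFactor F z.1 z.2) (U ×ˢ {0}ᶜ) := by
  have h1 : ContDiffOn ℝ ∞ (fun z : E n × E n => fderiv ℝ (fun x => F x z.2) z.1 z.2)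
      (U ×ˢ {0}ᶜ) := by
    refine ((h.smooth.fderiv_of_isOpen h.isOpen_prod (m := ∞) (by simp)).clm_apply
      (contDiffOn_snd.prodMk (contDiffOn_const (c := (0 : E n))))).congr fun z hz => ?_
    exact h.fderiv_horizontal hz.1 hz.2 z.2
  exact h1.div (contDiffOn_const.mul h.smooth)
    fun z hz => mul_ne_zero two_ne_zero (h.pos z.1 hz.1 z.2 hz.2).ne'

theorem projectiveFactor_smul (h : IsFinslerOn U F) {x : E n} (hx : x ∈ U) (y : E n) {r : ℝ}
    (hr : 0 < r) : projectiveFactor F x (r • y) = r ^ 1 * projectiveFactor F x y := by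
  rw [projectiveFactor, h.fderiv_horizontal_smul hx y hr.le, h.homogeneous x hx y r hr.le,
    projectiveFactor]
  simp only [map_smul, smul_apply, smul_eq_mul]
  field_simp

/-- The equation `F_{xᵘ} = (P F)_{yᵘ}`. -/
theorem fderiv_eq_of_projectivelyFlat (h : IsFinslerOn U F)
    (hpd : ∀ x ∈ U, ∀ y, y ≠ 0 → (fundamentalTensor F x y).PosDef)
    (hflat : IsProjectivelyFlatOn F U) {x y : E n} (hx : x ∈ U) (hy : y ≠ 0) (u : E n) :
    fderiv ℝ (fun z : E n × E n => F z.1 z.2) (x, y) (u, 0) =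
      fderiv ℝ (fun z : E n × E n => projectiveFactor F z.1 z.2) (x, y) (0, u) * F x y +
      projectiveFactor F x y * fderiv ℝ (fun z : E n × E n => F z.1 z.2) (x, y) (0, u) := by
  have e1 := h.energy_equation hpd hx hy (h.geodesicCoeff_eq hpd hflat hx hy) u
  have h1 := (h.hasFDerivAt_fderiv_of_contDiffOn h.contDiffOn_energy hx hy).clm_apply
    ((hasFDerivAt_snd (𝕜 := ℝ) (p := (x, y))).prodMk (hasFDerivAt_const (0 : E n) (x, y)))
  have h2 := ((h.hasFDerivAt_of_contDiffOn h.contDiffOn_projectiveFactor hx hy).const_mul 4).mul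
    (h.hasFDerivAt_of_contDiffOn h.contDiffOn_energy hx hy)
  -- Differentiate [F²]_{xᵏ}yᵏ = 4P F² in y and compare with `energy_equation`.
  have h3 := h2.congr_of_eventuallyEq (f₁ := fun z : E n × E n =>
    fderiv ℝ (fun z : E n × E n => energy F z.1 z.2) z (z.2, 0)) (by
    filter_upwards [h.isOpen_prod.mem_nhds (mk_mem_prod hx hy)] with z hz
    exact h.fderiv_energy_horizontal_self hz.1 hz.2)
  have e2 := congrArg (fun L : E n × E n →L[ℝ] ℝ => L (0, u)) (h1.unique h3)
  simp at e2
  rw [h.fderiv_fderiv_energy_symm hx hy (0, u)] at e2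
  simp only [h.fderiv_energy hx hy] at e1 e2
  simp only [energy] at e1 e2
  have hF := (h.pos x hx y hy).ne'
  refine mul_left_cancel₀ hF ?_
  linear_combination (1 / 4) * e2 + (1 / 4) * e1

/-- The divergence ∂(P yᵐ)/∂yᵐ is P_{yᵐ}yᵐ + nP = (n+1)P, as P is homogeneous of degree one. -/
theorem sCurvature_eq (h : IsFinslerOn U F)
    (hpd : ∀ x ∈ U, ∀ y, y ≠ 0 → (fundamentalTensor F x y).PosDef)
    (hflat : IsProjectivelyFlatOn F U) {x y : E n} (hx : x ∈ U) (hy : y ≠ 0) :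
    sCurvature F x y = (n + 1) * projectiveFactor F x y -
      fderiv ℝ (fun z => Real.log (busemannHausdorffDensity F z)) x y := by
  have hP := h.hasFDerivAt_of_contDiffOn h.contDiffOn_projectiveFactor hx hy
  have hPy := HasFDerivAt.comp (g := fun z : E n × E n => projectiveFactor F z.1 z.2)
    (f := fun y => (x, y)) y hP (hasFDerivAt_prodMk_right x y)
  have hG : ∀ m, dY (geodesicCoeff F m) m x y =
      fderiv ℝ (fun z : E n × E n => projectiveFactor F z.1 z.2) (x, y)
        (0, EuclideanSpace.single m 1) * y m + projectiveFactor F x y := by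
    intro m
    have h1 := hPy.mul (EuclideanSpace.proj (𝕜 := ℝ) m).hasFDerivAt
    have h2 := h1.congr_of_eventuallyEq (f₁ := fun w => geodesicCoeff F m x w) (by
      filter_upwards [isOpen_compl_singleton.mem_nhds hy] with w hw
      exact h.geodesicCoeff_eq hpd hflat hx hw m)
    rw [dY, h2.fderiv]
    simp
    ring
  have hE := fderiv_self_of_homogeneous hP (fun r hr => h.projectiveFactor_smul hx y hr)
  have hs1 := sum_apply_single_mul
    ((fderiv ℝ (fun z : E n × E n => projectiveFactor F z.1 z.2) (x, y)).comp
      (ContinuousLinearMap.inr ℝ (E n) (E n))) y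
  simp only [ContinuousLinearMap.comp_apply, ContinuousLinearMap.inr_apply] at hs1
  have hs2 := sum_apply_single_mul
    (fderiv ℝ (fun z => Real.log (busemannHausdorffDensity F z)) x) y
  rw [sCurvature, Finset.sum_congr rfl fun m _ => hG m, Finset.sum_add_distrib, hs1, hE, ← hs2]
  simp only [dX, mul_comm (y _)]
  simp
  ring

/-- A projectively flat metric of almost isotropic S-curvature satisfies the flat system. -/
theorem exists_flatSystem [NeZero n] (h : IsFinslerOn U F)
    (hpd : ∀ x ∈ U, ∀ y, y ≠ 0 → (fundamentalTensor F x y).PosDef)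
    (hflat : IsProjectivelyFlatOn F U) {c : E n → ℝ} (hc : ContDiffOn ℝ ∞ c U)
    {η : E n → E n →L[ℝ] ℝ} (hη : ContDiffOn ℝ ∞ η U)
    (hη' : ∀ x ∈ U, ∀ u w, fderiv ℝ η x u w = fderiv ℝ η x w u)
    (hS : ∀ x ∈ U, ∀ y, y ≠ 0 → sCurvature F x y = (n + 1) * (c x * F x y + η x y)) :
    ∃ θ, FlatSystem U F c θ := by
  have hn : ((n : ℝ) + 1) ≠ 0 := by positivity
  set lnσ : E n → ℝ := fun z => Real.log (busemannHausdorffDensity F z) with hσ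
  have hσd : ∀ x ∈ U, HasFDerivAt lnσ (fderiv ℝ lnσ x) x := fun x hx =>
    (h.differentiableAt_log_measure volume hx _).hasFDerivAt
  set θ : E n → E n →L[ℝ] ℝ := fun x => η x + ((n : ℝ) + 1)⁻¹ • fderiv ℝ lnσ x with hθ
  have hP : ∀ x ∈ U, ∀ y, y ≠ 0 → projectiveFactor F x y = c x * F x y + θ x y := by
    intro x hx y hy
    have h1 := hS x hx y hy
    rw [h.sCurvature_eq hpd hflat hx hy] at h1
    simp only [hθ, add_apply, smul_apply, smul_eq_mul]
    field_simp
    linarith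
  have hslice : ∀ {g : E n × E n → ℝ}, ContDiffOn ℝ ∞ g (U ×ˢ {0}ᶜ) → ∀ y, y ≠ 0 →
      ContDiffOn ℝ ∞ (fun x => g (x, y)) U := fun {g} hg y hy =>
    hg.comp (contDiff_prodMk_left y).contDiffOn fun x hx => ⟨hx, hy⟩
  -- ln σ_F is so far only differentiable; smoothness of θ comes from θ(y) = P − cF at a fixed y ≠
  -- 0.
  have hθs : ContDiffOn ℝ ∞ θ U := by
    rw [contDiffOn_clm_apply]
    intro y
    rcases eq_or_ne y 0 with rfl | hy
    · simpa using contDiffOn_const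
    · refine ((hslice h.contDiffOn_projectiveFactor y hy).sub
        (hc.mul (hslice h.smooth y hy))).congr fun x hx => ?_
      simp only [hP x hx y hy]
      ring
  have hθd : ∀ x ∈ U, HasFDerivAt θ (fderiv ℝ θ x) x := fun x hx =>
    ((hθs.contDiffAt (h.isOpen.mem_nhds hx)).differentiableAt (by simp)).hasFDerivAt
  have hηd : ∀ x ∈ U, HasFDerivAt η (fderiv ℝ η x) x := fun x hx =>
    ((hη.contDiffAt (h.isOpen.mem_nhds hx)).differentiableAt (by simp)).hasFDerivAt
  refine ⟨θ, h.isOpen, h.smooth, h.pos, h.homogeneous, hc, hθs, fun x hx u w => ?_,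
    fun x hx y hy u => ?_⟩
  -- Now d ln σ_F = (n+1)(θ − η) is itself differentiable, so its derivative is symmetric; with η
  -- closed, so is θ.
  · have e : fderiv ℝ lnσ = fun x => ((n : ℝ) + 1) • (θ x - η x) := by
      ext x y
      simp [hθ, hn]
    have h1 : HasFDerivAt (fderiv ℝ lnσ)
        (((n : ℝ) + 1) • (fderiv ℝ θ x - fderiv ℝ η x)) x := by
      rw [e]
      exact ((hθd x hx).sub (hηd x hx)).const_smul ((n : ℝ) + 1)
    have h2 := second_derivative_symmetric_of_eventually
      (by filter_upwards [h.isOpen.mem_nhds hx] with z hz using hσd z hz) h1 u w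
    simp only [smul_apply, sub_apply, smul_eq_mul, hη' x hx u w] at h2
    have := mul_left_cancel₀ hn h2
    linarith
  · have hcd : HasFDerivAt (fun z : E n × E n => c z.1)
        ((fderiv ℝ c x).comp (ContinuousLinearMap.fst ℝ (E n) (E n))) (x, y) :=
      HasFDerivAt.comp (x, y) ((hc.contDiffAt (h.isOpen.mem_nhds hx)).differentiableAt
        (by simp)).hasFDerivAt hasFDerivAt_fst
    have hθf : HasFDerivAt (fun z : E n × E n => θ z.1)
        ((fderiv ℝ θ x).comp (ContinuousLinearMap.fst ℝ (E n) (E n))) (x, y) :=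
      HasFDerivAt.comp (g := θ) (f := Prod.fst) (x, y) (hθd x hx) hasFDerivAt_fst
    have h1 := (hcd.mul (h.hasFDerivAt_of_contDiffOn h.smooth hx hy)).add
      (hθf.clm_apply hasFDerivAt_snd)
    have h2 := h1.congr_of_eventuallyEq
      (f₁ := fun z : E n × E n => projectiveFactor F z.1 z.2) (by
      filter_upwards [h.isOpen_prod.mem_nhds (mk_mem_prod hx hy)] with z hz
      exact hP z.1 hz.1 z.2 hz.2)
    rw [h.fderiv_eq_of_projectivelyFlat hpd hflat hx hy u, h2.fderiv, hP x hx y hy]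
    simp
    ring

end IsFinslerOn

/-! ### Passing between M and coordinates. -/

section Charts

variable {n : ℕ} {M : Type*} [TopologicalSpace M] [ChartedSpace (E n) M]
  {e : OpenPartialHomeomorph M (E n)}

theorem mdifferentiable_of_mem_maximalAtlas (he : e ∈ IsManifold.maximalAtlas (𝓡 n) ∞ M) :
    e.MDifferentiable (𝓡 n) (𝓡 n) :=
  ⟨(contMDiffOn_of_mem_maximalAtlas he).mdifferentiableOn (by simp),
    (contMDiffOn_symm_of_mem_maximalAtlas he).mdifferentiableOn (by simp)⟩

theorem contMDiff_mk_tangentBundle (n : ℕ) :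
    ContMDiff 𝓘(ℝ, E n × E n) (𝓡 n).tangent ∞
      (fun z : E n × E n => (⟨z.1, z.2⟩ : TangentBundle (𝓡 n) (E n))) := by
  intro z
  rw [Bundle.contMDiffAt_totalSpace]
  refine ⟨contDiff_fst.contMDiff z, ?_⟩
  convert! contDiff_snd.contMDiff z with y
  simp
  rfl

/-- The linear isomorphism `ℝⁿ → T_pM`, `p = e⁻¹(x)`, given by a coordinate system `e`. -/
def chartEquiv (he : e ∈ IsManifold.maximalAtlas (𝓡 n) ∞ M) {x : E n} (hx : x ∈ e.target) :
    E n ≃L[ℝ] TangentSpace (𝓡 n) (e.symm x) :=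
  (mdifferentiable_of_mem_maximalAtlas he).symm.mfderiv hx

theorem inChart_eq (he : e ∈ IsManifold.maximalAtlas (𝓡 n) ∞ M) {x : E n} (hx : x ∈ e.target)
    (F : TangentBundle (𝓡 n) M → ℝ) (y : E n) :
    inChart e F x y = F ⟨e.symm x, chartEquiv he hx y⟩ := rfl

variable [IsManifold (𝓡 n) ∞ M]

theorem contDiffOn_inChart {F : TangentBundle (𝓡 n) M → ℝ} (hF : IsFinslerMetric F)
    (he : e ∈ IsManifold.maximalAtlas (𝓡 n) ∞ M) :
    ContDiffOn ℝ ∞ (fun z : E n × E n => inChart e F z.1 z.2) (e.target ×ˢ {0}ᶜ) := by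
  have : IsManifold (𝓡 n) 1 M := .of_le (n := ∞) (by simp)
  have h1 := (contMDiffOn_symm_of_mem_maximalAtlas he).contMDiffOn_tangentMapWithin (m := ∞)
    (by simp) e.open_target.uniqueMDiffOn
  have h2 := h1.comp (contMDiff_mk_tangentBundle n).contMDiffOn
    (s := (e.target ×ˢ {0}ᶜ : Set (E n × E n))) (fun z hz => hz.1)
  have hw : ∀ z ∈ (e.target ×ˢ {0}ᶜ : Set (E n × E n)),
      tangentMapWithin (𝓡 n) (𝓡 n) e.symm e.target ⟨z.1, z.2⟩ =
        ⟨e.symm z.1, mfderiv (𝓡 n) (𝓡 n) e.symm z.1 z.2⟩ := by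
    intro z hz
    rw [tangentMapWithin, mfderivWithin_of_isOpen e.open_target hz.1]
  have h3 := hF.smooth.comp h2 fun z hz => by
    have h4 := hw z hz
    change (tangentMapWithin (𝓡 n) (𝓡 n) e.symm e.target ⟨z.1, z.2⟩).2 ≠ 0
    rw [h4]
    exact (chartEquiv he hz.1).map_ne_zero_iff.mpr hz.2
  rw [← contMDiffOn_iff_contDiffOn]
  refine h3.congr fun z hz => ?_
  exact congrArg F (hw z hz).symm

theorem isFinslerOn_inChart {F : TangentBundle (𝓡 n) M → ℝ} (hF : IsFinslerMetric F)
    (he : e ∈ IsManifold.maximalAtlas (𝓡 n) ∞ M) : IsFinslerOn e.target (inChart e F) where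
  isOpen := e.open_target
  smooth := contDiffOn_inChart hF he
  pos x hx y hy := by
    rw [inChart_eq he hx]
    refine (hF.nonneg _).lt_of_ne fun h0 => ?_
    exact (chartEquiv he hx).map_ne_zero_iff.mpr hy ((hF.eq_zero_iff _).mp h0.symm)
  homogeneous x hx y r hr := by
    rw [inChart_eq he hx, inChart_eq he hx, map_smul]
    exact hF.homogeneous _ _ r hr

theorem FlatSystem.mono {V : Type*} [NormedAddCommGroup V] [NormedSpace ℝ V] {B B' : Set V}
    {F : V → V → ℝ} {c : V → ℝ} {θ : V → V →L[ℝ] ℝ} (h : FlatSystem B F c θ) (hB' : IsOpen B')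
    (hsub : B' ⊆ B) : FlatSystem B' F c θ where
  isOpen := hB'
  smooth := h.smooth.mono (prod_mono hsub subset_rfl)
  pos x hx := h.pos x (hsub hx)
  homogeneous x hx := h.homogeneous x (hsub hx)
  smooth_c := h.smooth_c.mono hsub
  smooth_θ := h.smooth_θ.mono hsub
  closed x hx := h.closed x (hsub hx)
  system x hx := h.system x (hsub hx)

theorem IsRandersNorm.comp {V W : Type*} [AddCommGroup V] [Module ℝ V] [TopologicalSpace V]
    [IsTopologicalAddGroup V] [ContinuousSMul ℝ V] [AddCommGroup W] [Module ℝ W]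
    [TopologicalSpace W] [IsTopologicalAddGroup W] [ContinuousSMul ℝ W] {N : W → ℝ}
    (h : IsRandersNorm N) (L : V ≃L[ℝ] W) : IsRandersNorm (fun v => N (L v)) := by
  obtain ⟨a, b, hs, hp, hN⟩ := h
  have h1 : ∃ A : V →L[ℝ] V →L[ℝ] ℝ, ∀ v w, A v w = a (L v) (L w) :=
    ⟨(ContinuousLinearMap.precomp ℝ (L : V →L[ℝ] W)).comp (a.comp (L : V →L[ℝ] W)),
      fun _ _ => rfl⟩
  obtain ⟨A, hA⟩ := h1
  refine ⟨A, b.comp (L : V →L[ℝ] W), fun v w => ?_, fun v hv => ?_, fun v => ?_⟩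
  · rw [hA, hA, hs]
  · rw [hA]
    exact hp _ (L.map_ne_zero_iff.mpr hv)
  · rw [hA]
    exact hN (L v)

end Charts

/-! ### Positive definite forms, the dual norm and dimension at most one. -/

section PosDef

variable {V : Type*} [NormedAddCommGroup V] [NormedSpace ℝ V] [FiniteDimensional ℝ V]

theorem exists_mul_norm_sq_le (a : V →L[ℝ] V →L[ℝ] ℝ) (ha : ∀ v, v ≠ 0 → 0 < a v v) :
    ∃ k > 0, ∀ v, k * ‖v‖ ^ 2 ≤ a v v := by
  rcases subsingleton_or_nontrivial V with hV | hV
  · exact ⟨1, one_pos, fun v => by simp [Subsingleton.elim v 0]⟩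
  have hc : Continuous fun v => a v v := by fun_prop
  obtain ⟨v₀, hv₀, hmin⟩ := (isCompact_sphere (0 : V) 1).exists_isMinOn
    (NormedSpace.sphere_nonempty.mpr zero_le_one) hc.continuousOn
  have hv₀' : v₀ ≠ 0 := norm_ne_zero_iff.mp (by simp [mem_sphere_zero_iff_norm.mp hv₀])
  refine ⟨a v₀ v₀, ha _ hv₀', fun v => ?_⟩
  rcases eq_or_ne v 0 with rfl | hv
  · simp
  have hn : ‖v‖ ≠ 0 := norm_ne_zero_iff.mpr hv
  have h1 : a v₀ v₀ ≤ a (‖v‖⁻¹ • v) (‖v‖⁻¹ • v) :=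
    hmin (by simp [norm_smul, hn])
  simp only [map_smul, smul_apply, smul_eq_mul] at h1
  calc a v₀ v₀ * ‖v‖ ^ 2 ≤ ‖v‖⁻¹ * (‖v‖⁻¹ * a v v) * ‖v‖ ^ 2 := by gcongr
    _ = a v v := by field_simp

theorem isBounded_setOf_apply_le_one (a : V →L[ℝ] V →L[ℝ] ℝ) (ha : ∀ v, v ≠ 0 → 0 < a v v) :
    Bornology.IsBounded {v | a v v ≤ 1} := by
  obtain ⟨k, hk, hkv⟩ := exists_mul_norm_sq_le a ha
  rw [isBounded_iff_forall_norm_le]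
  refine ⟨Real.sqrt k⁻¹, fun v hv => Real.le_sqrt_of_sq_le ?_⟩
  rw [← one_div, le_div_iff₀' hk]
  exact (hkv v).trans hv

theorem isVonNBounded_setOf_apply_lt_one (a : V →L[ℝ] V →L[ℝ] ℝ)
    (ha : ∀ v, v ≠ 0 → 0 < a v v) : Bornology.IsVonNBounded ℝ {v | a v v < 1} :=
  (NormedSpace.isVonNBounded_iff ℝ).mpr
    ((isBounded_setOf_apply_le_one a ha).subset fun v (hv : a v v < 1) => hv.le)

/-- The dual norm of the linear part of a positive Randers norm is less than `1`. -/
theorem sSup_image_lt_one (a : V →L[ℝ] V →L[ℝ] ℝ) (ha : ∀ v, v ≠ 0 → 0 < a v v)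
    (b : V →L[ℝ] ℝ) (hb : ∀ v, v ≠ 0 → 0 < Real.sqrt (a v v) + b v) :
    sSup ((fun v => b v) '' {v | a v v ≤ 1}) < 1 := by
  have hc : Continuous fun v => a v v := by fun_prop
  have hcpt : IsCompact {v | a v v ≤ 1} :=
    Metric.isCompact_of_isClosed_isBounded (isClosed_le hc continuous_const)
      (isBounded_setOf_apply_le_one a ha)
  obtain ⟨v₀, hv₀, hmax⟩ := hcpt.exists_sSup_image_eq ⟨0, by simp⟩ b.continuous.continuousOn
  rw [hmax]
  rcases eq_or_ne v₀ 0 with rfl | h0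
  · simp
  -- Positivity at −v₀ reads b(v₀) < √a(v₀, v₀) ≤ 1 at the maximiser v₀.
  · have h1 := hb (-v₀) (neg_ne_zero.mpr h0)
    simp only [map_neg, neg_apply, neg_neg] at h1
    have h2 : Real.sqrt (a v₀ v₀) ≤ 1 := Real.sqrt_le_one.mpr hv₀
    linarith

/-- In dimension at most one every Minkowski norm is of Randers type. -/
theorem isRandersNorm_of_le_one {n : ℕ} (hn : n ≤ 1) {N : E n → ℝ}
    (hN : ∀ y, ∀ r : ℝ, 0 ≤ r → N (r • y) = r * N y) (hpos : ∀ y, y ≠ 0 → 0 < N y) :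
    IsRandersNorm N := by
  have h0 : N 0 = 0 := by simpa using hN 0 0 le_rfl
  interval_cases n
  · refine ⟨0, 0, by simp, fun v hv => absurd (Subsingleton.elim v 0) hv, fun v => ?_⟩
    rw [Subsingleton.elim v 0]
    simpa using h0
  · set v : E 1 := EuclideanSpace.single 0 1 with hv
    have hv0 : v ≠ 0 := by simp [hv]
    have hy : ∀ y : E 1, y = y 0 • v := fun y => by
      ext i
      fin_cases i
      simp [hv]
    have hp1 := hpos v hv0
    have hp2 := hpos (-v) (neg_ne_zero.mpr hv0)
    set L : E 1 →L[ℝ] ℝ := EuclideanSpace.proj 0 with hL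
    have hLy : ∀ y : E 1, L y = y 0 := fun y => rfl
    -- The even and odd parts of N on the basis vector.
    refine ⟨(((N v + N (-v)) / 2) ^ 2) • L.smulRight L, ((N v - N (-v)) / 2) • L,
      fun y w => ?_, fun y hy0 => ?_, fun y => ?_⟩
    · simp [mul_comm]
    · have : y 0 ≠ 0 := fun h => hy0 (by rw [hy y, h, zero_smul])
      simp only [smul_apply, ContinuousLinearMap.smulRight_apply, smul_eq_mul, hLy]
      have := mul_self_pos.mpr this
      positivity
    · have e : (((N v + N (-v)) / 2) ^ 2) * (y 0 * y 0) = ((N v + N (-v)) / 2 * y 0) ^ 2 := by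
        ring
      simp only [smul_apply, ContinuousLinearMap.smulRight_apply, smul_eq_mul, hLy, e,
        Real.sqrt_sq_eq_abs, abs_mul, abs_of_pos (half_pos (add_pos hp1 hp2))]
      rcases le_total 0 (y 0) with h | h
      · rw [abs_of_nonneg h]
        conv_lhs => rw [hy y, hN _ _ h]
        ring
      · rw [abs_of_nonpos h]
        conv_lhs => rw [hy y, ← neg_smul_neg, hN _ _ (neg_nonneg.mpr h)]
        ring

end PosDef

/-! ### F is a Randers norm on each tangent space. -/

section Pointwise

variable {n : ℕ} {M : Type*} [TopologicalSpace M] [ChartedSpace (E n) M]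
  {F : TangentBundle (𝓡 n) M → ℝ}

theorem isRandersNorm_of_inChart {e : OpenPartialHomeomorph M (E n)}
    (he : e ∈ IsManifold.maximalAtlas (𝓡 n) ∞ M) {p : M} (hp : p ∈ e.source)
    (h : IsRandersNorm (inChart e F (e p))) :
    IsRandersNorm (fun v : TangentSpace (𝓡 n) p => F ⟨p, v⟩) := by
  have hx : e p ∈ e.target := e.map_source hp
  have h1 := h.comp (chartEquiv he hx).symm
  simp only [inChart_eq he hx, ContinuousLinearEquiv.apply_symm_apply] at h1
  rwa [e.left_inv hp] at h1

variable [IsManifold (𝓡 n) ∞ M]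

/-- Around every point the flat system holds on a ball in suitable coordinates. -/
theorem exists_flatSystem_ball (hn : 1 < n) (hF : IsFinslerMetric F)
    (hflat : IsLocallyProjectivelyFlat F) {c : M → ℝ} (hc : ContMDiff (𝓡 n) 𝓘(ℝ, ℝ) ∞ c)
    {η : ∀ p : M, TangentSpace (𝓡 n) p →L[ℝ] ℝ} (hη : IsSmoothForm η) (hη' : IsClosedForm η)
    (hS : SCurvatureEq F c η) (p : M) :
    ∃ e ∈ IsManifold.maximalAtlas (𝓡 n) ∞ M, p ∈ e.source ∧ ∃ B, Convex ℝ B ∧ e p ∈ B ∧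
      B ⊆ e.target ∧ ∃ θ, FlatSystem B (inChart e F) (c ∘ e.symm) θ := by
  obtain ⟨e, he, hp, hpf⟩ := hflat p
  have : NeZero n := ⟨by omega⟩
  have hcs : ContDiffOn ℝ ∞ (c ∘ e.symm) e.target :=
    (hc.comp_contMDiffOn (contMDiffOn_symm_of_mem_maximalAtlas he)).contDiffOn
  obtain ⟨θ, hθ⟩ := (isFinslerOn_inChart hF he).exists_flatSystem (hF.strongly_convex e he) hpf
    hcs (hη e he) (hη' e he) (hS e he)
  obtain ⟨r, hr, hrt⟩ := Metric.isOpen_iff.mp e.open_target _ (e.map_source hp)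
  exact ⟨e, he, hp, Metric.ball (e p) r, convex_ball _ _, Metric.mem_ball_self hr, hrt, θ,
    hθ.mono Metric.isOpen_ball hrt⟩

theorem one_lt_rank (hn : 1 < n) : 1 < Module.rank ℝ (E n) := by
  rw [← Module.finrank_eq_rank, finrank_euclideanSpace_fin]
  exact_mod_cast hn

theorem isRandersNorm_of_sCurvatureEq [ConnectedSpace M] (hF : IsFinslerMetric F)
    (hflat : IsLocallyProjectivelyFlat F) {c : M → ℝ} (hc : ContMDiff (𝓡 n) 𝓘(ℝ, ℝ) ∞ c)
    {η : ∀ p : M, TangentSpace (𝓡 n) p →L[ℝ] ℝ} (hη : IsSmoothForm η) (hη' : IsClosedForm η)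
    (hS : SCurvatureEq F c η) (hnc : ¬ ∃ k : ℝ, ∀ p : M, c p = k) (p : M) :
    IsRandersNorm (fun v : TangentSpace (𝓡 n) p => F ⟨p, v⟩) := by
  rcases le_or_gt n 1 with hn | hn
  · have hch : chartAt (E n) p ∈ IsManifold.maximalAtlas (𝓡 n) ∞ M :=
      IsManifold.chart_mem_maximalAtlas p
    have hfc := isFinslerOn_inChart hF hch
    have hx := mem_chart_target (E n) p
    exact isRandersNorm_of_inChart hch (mem_chart_source (E n) p)
      (isRandersNorm_of_le_one hn (hfc.homogeneous _ hx) (hfc.pos _ hx))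
  have hloc := exists_flatSystem_ball hn hF hflat hc hη hη' hS
  have transfer : ∀ {e : OpenPartialHomeomorph M (E n)} {q : M}, q ∈ e.source →
      ((∀ᶠ x in 𝓝 (e q), (c ∘ e.symm) x = (c ∘ e.symm) (e q)) ↔ ∀ᶠ z in 𝓝 q, c z = c q) := by
    intro e q hq
    rw [← e.map_nhds_eq hq, Filter.eventually_map]
    refine Filter.eventually_congr ?_
    filter_upwards [e.open_source.mem_nhds hq] with z hz
    simp only [Function.comp_apply, e.left_inv hz, e.left_inv hq]
  set T : Set M := {q | ∀ᶠ z in 𝓝 q, c z = c q} with hT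
  have hTo : IsOpen T := by
    rw [isOpen_iff_mem_nhds]
    intro q hq
    have hq : ∀ᶠ z in 𝓝 q, c z = c q := hq
    filter_upwards [hq.eventually_nhds, hq] with z hz hz'
    change ∀ᶠ w in 𝓝 z, c w = c z
    rwa [hz']
  -- The ball around a limit point q meets T, and local constancy at one of its points spreads over
  -- the whole ball, in particular to q.
  have hTc : IsClosed T := by
    rw [← closure_subset_iff_isClosed]
    intro q hq
    obtain ⟨e, he, hqe, B, hB, hqB, hBt, θ, hθ⟩ := hloc q
    have hopen : IsOpen (e.source ∩ e ⁻¹' B) := e.isOpen_inter_preimage hθ.isOpen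
    obtain ⟨z, ⟨hze, hzB⟩, hzT⟩ := mem_closure_iff.mp hq _ hopen ⟨hqe, hqB⟩
    have h1 := (transfer hze).mpr hzT
    have h2 := fun x hx => hθ.eq_const_of_eventually_eq hB (one_lt_rank hn) hzB h1 (x := x) hx
    refine (transfer hqe).mp ?_
    filter_upwards [hθ.isOpen.mem_nhds hqB] with x hx
    rw [h2 x hx, h2 _ hqB]
  rcases isClopen_iff.mp ⟨hTc, hTo⟩ with hE | hU
  · obtain ⟨e, he, hpe, B, hB, hpB, hBt, θ, hθ⟩ := hloc p
    refine isRandersNorm_of_inChart he hpe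
      (hθ.isRandersNorm hB (one_lt_rank hn) hpB fun h => ?_)
    have : p ∈ T := (transfer hpe).mp h
    rw [hE] at this
    exact this
  · have hlc : IsLocallyConstant c := by
      rw [IsLocallyConstant.iff_eventually_eq]
      exact fun q => (hU ▸ mem_univ q : q ∈ T)
    exact absurd ⟨c p, fun q => hlc.apply_eq_of_preconnectedSpace q p⟩ hnc

end Pointwise

/-! ### Smoothness of α and β. -/

section Global

variable {n : ℕ} {M : Type*} [TopologicalSpace M] [ChartedSpace (E n) M]

theorem contMDiffAt_clm_clm {g : M → E n →L[ℝ] E n →L[ℝ] ℝ} {p : M}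
    (hg : ∀ v w, ContMDiffAt (𝓡 n) 𝓘(ℝ, ℝ) ∞ (fun x => g x v w) p) :
    ContMDiffAt (𝓡 n) 𝓘(ℝ, E n →L[ℝ] E n →L[ℝ] ℝ) ∞ g p := by
  have e : g = fun x => ∑ i, ∑ j, g x (EuclideanSpace.single i 1) (EuclideanSpace.single j 1) •
      (EuclideanSpace.proj (𝕜 := ℝ) i : E n →L[ℝ] ℝ).smulRight
        (EuclideanSpace.proj (𝕜 := ℝ) j : E n →L[ℝ] ℝ) := by
    ext x v w
    have h1 := sum_apply_single_mul ((g x).flip w) v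
    simp only [ContinuousLinearMap.flip_apply] at h1
    rw [← h1]
    simp only [sum_apply, smul_apply, ContinuousLinearMap.smulRight_apply,
      smul_eq_mul]
    refine Finset.sum_congr rfl fun i _ => ?_
    rw [← sum_apply_single_mul (g x (EuclideanSpace.single i 1)) w, Finset.sum_mul]
    exact Finset.sum_congr rfl fun j _ => by
      change _ = _ * (v i * w j)
      ring
  rw [e]
  exact ContMDiffAt.sum fun i _ => ContMDiffAt.sum fun j _ =>
    (hg _ _).smul contMDiffAt_const

variable [IsManifold (𝓡 n) ∞ M] {F : TangentBundle (𝓡 n) M → ℝ}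

/-- A Finsler metric is smooth along the coordinate vector fields. -/
theorem contMDiffOn_symmL (hF : IsFinslerMetric F) (p : M) {v : E n} (hv : v ≠ 0) :
    ContMDiffOn (𝓡 n) 𝓘(ℝ, ℝ) ∞
      (fun x => F ⟨x, (trivializationAt (E n) (TangentSpace (𝓡 n)) p).symmL ℝ x v⟩)
      (trivializationAt (E n) (TangentSpace (𝓡 n)) p).baseSet := by
  set t := trivializationAt (E n) (TangentSpace (𝓡 n) : M → Type _) p with ht
  have h1 : ContMDiffOn (𝓡 n) (𝓡 n).tangent ∞
      (fun x => (⟨x, t.symmL ℝ x v⟩ : TangentBundle (𝓡 n) M)) t.baseSet := by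
    have h2 := (t.contMDiffOn_symm (IB := 𝓡 n) (n := ∞)).comp
      (contMDiffOn_id.prodMk (contMDiffOn_const (c := v)) : ContMDiffOn (𝓡 n)
        ((𝓡 n).prod 𝓘(ℝ, E n)) ∞ (fun x : M => (x, v)) t.baseSet)
      (fun x hx => t.mem_target.mpr hx)
    refine h2.congr fun x hx => ?_
    rw [t.symmL_apply hx]
    exact t.mk_symm hx v
  refine hF.smooth.comp h1 fun x hx => ?_
  change t.symmL ℝ x v ≠ 0
  intro h0
  have := t.continuousLinearMapAt_symmL (R := ℝ) hx v
  rw [h0, map_zero] at this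
  exact hv this.symm

/-- No regularity in p is assumed of the pointwise data. But β is the odd part of F and α² the
square of its even part, so both inherit smoothness from F; the bilinear form follows by
polarisation. -/
theorem isRandersMetric_of_isRandersNorm (hF : IsFinslerMetric F)
    (h : ∀ p : M, IsRandersNorm (fun v : TangentSpace (𝓡 n) p => F ⟨p, v⟩)) :
    IsRandersMetric F := by
  choose a b hs hp hN using h
  have hFp : ∀ (p : M) (v : TangentSpace (𝓡 n) p), v ≠ 0 → 0 < F ⟨p, v⟩ := fun p v hv =>
    (hF.nonneg _).lt_of_ne fun h0 => hv ((hF.eq_zero_iff _).mp h0.symm)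
  have hb : ∀ p v, b p v = (F ⟨p, v⟩ - F ⟨p, -v⟩) / 2 := by
    intro p v
    have h1 := hN p v
    have h2 := hN p (-v)
    simp only [map_neg, neg_apply, neg_neg] at h1 h2
    linarith
  have ha : ∀ p v, a p v v = ((F ⟨p, v⟩ + F ⟨p, -v⟩) / 2) ^ 2 := by
    intro p v
    have h1 := hN p v
    have h2 := hN p (-v)
    simp only [map_neg, neg_apply, neg_neg] at h1 h2
    have h0 : 0 ≤ a p v v := by
      rcases eq_or_ne v 0 with rfl | hv
      · simp
      · exact (hp p v hv).le
    have h3 : (F ⟨p, v⟩ + F ⟨p, -v⟩) / 2 = Real.sqrt (a p v v) := by linarith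
    rw [h3, Real.sq_sqrt h0]
  have hpol : ∀ p v w, a p v w = (a p (v + w) (v + w) - a p (v - w) (v - w)) / 4 := by
    intro p v w
    simp only [map_add, map_sub, add_apply, sub_apply, hs p w v]
    ring
  have hsmooth : ContMDiff (𝓡 n) ((𝓡 n).prod 𝓘(ℝ, E n →L[ℝ] E n →L[ℝ] ℝ)) ∞
      (fun p => Bundle.TotalSpace.mk' (E n →L[ℝ] E n →L[ℝ] ℝ)
        (E := fun p : M => TangentSpace (𝓡 n) p →L[ℝ] TangentSpace (𝓡 n) p →L[ℝ] ℝ) p (a p)) := by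
    intro p
    rw [contMDiffAt_hom_bundle]
    refine ⟨contMDiffAt_id, contMDiffAt_clm_clm fun v w => ?_⟩
    set t := trivializationAt (E n) (TangentSpace (𝓡 n) : M → Type _) p with ht
    have hmem : p ∈ t.baseSet := FiberBundle.mem_baseSet_trivializationAt' p
    have hdiag : ∀ v : E n, ContMDiffAt (𝓡 n) 𝓘(ℝ, ℝ) ∞
        (fun x => a x (t.symmL ℝ x v) (t.symmL ℝ x v)) p := by
      intro v
      -- F is not smooth on the zero section, so v = 0 is separate; there the function is constant.
      rcases eq_or_ne v 0 with rfl | hv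
      · simp only [map_zero]
        exact contMDiffAt_const
      · have h1 := (contMDiffOn_symmL hF p hv).contMDiffAt (t.open_baseSet.mem_nhds hmem)
        have h2 := (contMDiffOn_symmL hF p (neg_ne_zero.mpr hv)).contMDiffAt
          (t.open_baseSet.mem_nhds hmem)
        simp only [map_neg] at h2
        simp only [ha]
        exact ((contDiff_id.div_const (2 : ℝ)).pow 2).contMDiff.contMDiffAt.comp p (h1.add h2)
    have h3 := ((contDiff_id.div_const (4 : ℝ)).contMDiff.contMDiffAt.comp p
      ((hdiag (v + w)).sub (hdiag (v - w))))
    refine h3.congr_of_eventuallyEq ?_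
    filter_upwards [t.open_baseSet.mem_nhds hmem] with x hx
    refine (inCoordinates_apply_eq₂ hx hx (mem_univ _)).trans ?_
    rw [← t.symmL_apply (R := ℝ) hx, ← t.symmL_apply (R := ℝ) hx]
    simp only [Function.comp_apply, id]
    rw [map_add, map_sub]
    refine Eq.trans ?_ (hpol _ _ _)
    exact congrFun (Bundle.Trivialization.coe_linearMapAt_of_mem (R := ℝ) _ (mem_univ x)) _
  refine ⟨{ inner := a
            symm := hs
            pos := hp
            isVonNBounded := fun p => isVonNBounded_setOf_apply_lt_one (V := E n) (a p) (hp p)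
            contMDiff := hsmooth }, b, ?_, fun p => ?_, hN⟩
  · intro e he
    rw [contDiffOn_clm_apply]
    intro y
    rcases eq_or_ne y 0 with rfl | hy
    · simpa using contDiffOn_const
    · have hsl : ∀ y : E n, y ≠ 0 → ContDiffOn ℝ ∞ (fun x => inChart e F x y) e.target :=
        fun y hy => (contDiffOn_inChart hF he).comp (contDiff_prodMk_left y).contDiffOn
          fun x hx => ⟨hx, hy⟩
      refine (((hsl y hy).sub (hsl (-y) (neg_ne_zero.mpr hy))).div_const 2).congr fun x hx => ?_
      change b _ (chartEquiv he hx y) =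
        (F ⟨_, chartEquiv he hx y⟩ - F ⟨_, chartEquiv he hx (-y)⟩) / 2
      rw [map_neg]
      exact hb _ _
  · refine sSup_image_lt_one (V := E n) (a p) (hp p) (b p) fun v hv => ?_
    exact (hFp p v hv).trans_eq (hN p v)

end Global

end

theorem mainTheorem4 {n : ℕ} {M : Type*} [TopologicalSpace M] [T2Space M]
    [SecondCountableTopology M] [ConnectedSpace M] [ChartedSpace (E n) M] [IsManifold (𝓡 n) ∞ M]
    (F : TangentBundle (𝓡 n) M → ℝ) (hF : IsFinslerMetric F)
    (hflat : IsLocallyProjectivelyFlat F)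
    (c : M → ℝ) (hc : ContMDiff (𝓡 n) 𝓘(ℝ, ℝ) ∞ c)
    (η : ∀ p : M, TangentSpace (𝓡 n) p →L[ℝ] ℝ) (hη : IsSmoothForm η) (hη' : IsClosedForm η)
    (hS : SCurvatureEq F c η)
    (hnc : ¬ ∃ k : ℝ, ∀ p : M, c p = k) :
    IsRandersMetric F :=
  isRandersMetric_of_isRandersNorm hF
    (isRandersNorm_of_sCurvatureEq hF hflat hc hη hη' hS hnc)
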